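/- Fix $u>0$, a positive integer $d$ and a positive semidefinite $d\times d$ matrix $L$. Let $h$ denote differential entropy (in nats, with $h=-\infty$ for distributions without a Lebesgue density), let $\gamma_K$ be the centered Gaussian measure on $\mathbb{R}^d$ with covariance matrix $K$, and let $*$ denote convolution. For a probability distribution $P_X$ on $\mathbb{R}^d$ with finite second moments put $$\Psi(P_X,L):=\sup_{P_Y:\ \mathrm{cov}(P_Y)\preceq L}\bigl\{u\,h(P_X*\gamma_{uI}*P_Y)+h(P_X)-(1+u)\,h(P_X*\gamma_{uI})\bigr\},$$ $$\Theta(P_X,L):=\frac u2\ln\bigl[(2\pi e)^d\det(\mathrm{cov}(P_X)+uI+L)\bigr]+h(P_X)-(1+u)\,h(P_X*\gamma_{uI}),\qquad \Phi(L):=\sup_{K\succeq0}\Theta(\gamma_K,L),$$ where the first supremum is over probability distributions $P_Y$ on $\mathbb{R}^d$ with finite second moments and covariance $\preceq L$, and the last one over positive semidefinite $d\times d$ matrices $K$. Suppose that $K$ is a maximizer in the definition of $\Phi(L)$ and that the top eigenvalue of $K$ is strictly smaller than $\frac{u}{(1+u)^{1/3}-1}$. Then there exists $\epsilon>0$ such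 that every probability distribution $P_X$ on $\mathbb{R}^d$ with $\int x\,dP_X(x)=0$ and $\|P_X-\gamma_K\|_{L^\infty(\gamma_K)}\le\epsilon$ satisfies $\Theta(P_X,L)\le\Phi(L)$, and consequently $\Psi(P_X,L)\le\Phi(L)$. Here $\|P_X-\gamma_K\|_{L^\infty(\gamma_K)}$ is the $\gamma_K$-essential supremum of $\bigl|\frac{dP_X}{d\gamma_K}-1\bigr|$, taken to be $\infty$ if $P_X$ is not absolutely continuous with respect to $\gamma_K$. -/

import Mathlib

open MeasureTheory ProbabilityTheory
open scoped ENNReal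

noncomputable section

/-- The differential entropy `h(P) = -∫ p ln p` (in nats) of a measure `P` on `ℝ^d` with Lebesgue
density `p`, as the integral of the positive part of `-p ln p` minus the integral of its negative
part, with the usual convention `h(P) = -∞` when `P` has no density. -/
def diffEntropy {d : ℕ} (P : Measure (EuclideanSpace ℝ (Fin d))) : EReal :=
  open Classical in
  if P ≪ volume then
    ((∫⁻ x, ENNReal.ofReal (Real.negMulLog (P.rnDeriv volume x).toReal) : ℝ≥0∞) : EReal) -
      ((∫⁻ x, ENNReal.ofReal (-Real.negMulLog (P.rnDeriv volume x).toReal) : ℝ≥0∞) : EReal)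
  else ⊥

/-- The covariance matrix of a distribution on `ℝ^d` (with finite second moments). -/
def covMat {d : ℕ} (P : Measure (EuclideanSpace ℝ (Fin d))) : Matrix (Fin d) (Fin d) ℝ :=
  Matrix.of fun i j => covariance (fun x => x i) (fun x => x j) P

/-- `γ_K`: the centered Gaussian measure on `ℝ^d` with covariance matrix `K`. -/
def gaussianCov {d : ℕ} (K : Matrix (Fin d) (Fin d) ℝ) : Measure (EuclideanSpace ℝ (Fin d)) :=
  multivariateGaussian 0 K

/-- `γ_{uI}`. -/
def gaussianIso (d : ℕ) (u : ℝ) : Measure (EuclideanSpace ℝ (Fin d)) :=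
  gaussianCov (u • (1 : Matrix (Fin d) (Fin d) ℝ))

/-- `Ψ(P, L) = sup { u h(P * γ_{uI} * Q) + h(P) - (1 + u) h(P * γ_{uI}) }`, over all probability
distributions `Q` on `ℝ^d` with finite second moments and `cov(Q) ≼ L`. -/
def Psi {d : ℕ} (u : ℝ) (P : Measure (EuclideanSpace ℝ (Fin d)))
    (L : Matrix (Fin d) (Fin d) ℝ) : EReal :=
  ⨆ (Q : Measure (EuclideanSpace ℝ (Fin d)))
    (_ : IsProbabilityMeasure Q ∧ MemLp id 2 Q ∧ (L - covMat Q).PosSemidef),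
    (u : EReal) * diffEntropy ((P.conv (gaussianIso d u)).conv Q) + diffEntropy P
      - ((1 + u : ℝ) : EReal) * diffEntropy (P.conv (gaussianIso d u))

/-- `Θ(P, L) = (u/2) ln((2πe)^d det(cov(P) + uI + L)) + h(P) - (1 + u) h(P * γ_{uI})`. -/
def Theta {d : ℕ} (u : ℝ) (P : Measure (EuclideanSpace ℝ (Fin d)))
    (L : Matrix (Fin d) (Fin d) ℝ) : EReal :=
  ((u / 2 * Real.log ((2 * Real.pi * Real.exp 1) ^ d *
      (covMat P + u • (1 : Matrix (Fin d) (Fin d) ℝ) + L).det) : ℝ) : EReal)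
    + diffEntropy P
    - ((1 + u : ℝ) : EReal) * diffEntropy (P.conv (gaussianIso d u))

/-- `Φ(L)`: the supremum of `Θ(γ_K, L)` over all positive semidefinite `K`. -/
def Phi {d : ℕ} (u : ℝ) (L : Matrix (Fin d) (Fin d) ℝ) : EReal :=
  ⨆ (K : Matrix (Fin d) (Fin d) ℝ) (_ : K.PosSemidef), Theta u (gaussianCov K) L

/-- `‖P - Q‖_{L^∞(Q)}`: the essential supremum, with respect to `Q`, of the absolute value of the
density of `P - Q` with respect to `Q`; it is `∞` if there is no such density. -/
def linftyDist {d : ℕ} (P Q : Measure (EuclideanSpace ℝ (Fin d))) : ℝ≥0∞ :=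
  open Classical in
  if P ≪ Q then eLpNorm (fun x => (P.rnDeriv Q x).toReal - 1) ∞ Q else ∞

end

/-! Write K' = cov(P), D for relative entropy. For centered P of nonsingular covariance, h(P) =
h(γ_{K'}) − D(P‖γ_{K'}), and likewise after convolution with γ_{uI}. When the divergences are
finite, Θ(γ_{K'}, L) − Θ(P, L) is therefore D(P‖γ_{K'}) − (1+u) D(P*γ_{uI}‖γ_{K'}*γ_{uI}). Since K'
is a competitor in Φ(L), it suffices that adding γ_{uI} contracts the divergence by the factor 1+u
when P is close to γ_K; this is `exists_klDiv_conv_le`. Passing from Θ to Ψ uses only that Gaussians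
maximize entropy at given covariance and that det is monotone. If K is singular, every P ≪ γ_K is
singular too and both functionals are −∞.

The contraction is a third-order effect. In whitened coordinates, near the Gaussian, D is about half
the squared L² distance of the densities. P and γ_{K'} share all moments of order at most two, so
the difference of densities is orthogonal to quadratic polynomials, and the Ornstein-Uhlenbeck
operator of correlation ρ shrinks its L² norm by ρ³ (`OrthQuadratic.integral_ouOp_sq_le`). Hence D
shrinks by nearly ρ⁶. With ρ² = 1/(1+s), this step amounts to adding noise of covariance about sK.
It fits inside uI if s times the top eigenvalue is below u, and it contracts enough if (1+s)³ > 1+u;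
the eigenvalue hypothesis is exactly what leaves room for such an s. The remaining noise can only
decrease D, by data processing.

The factor ρ³ is obtained without Hermite expansions: log-convexity of t ↦ ⟨f, P_t f⟩ along repeated
squaring of t, combined with ⟨f, P_t f⟩ = O(t³) as t → 0, which is read off the Taylor expansion of
Mehler's kernel.

Comparing D with the L² distance is not uniform in space, because the densities relative to the
standard Gaussian are bounded below only by a multiple of exp(−η‖x‖²). The lost weight is absorbed
by `exists_integral_ouOp_sq_mul_exp_le`: after noise, the difference is square integrable even
against a growing Gaussian weight. `exists_klDiv_ouMeasure_le` combines the two L² bounds. -/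

/-! ### Rotation invariance of the Gaussian and the Ornstein-Uhlenbeck operator. -/

section OrnsteinUhlenbeck

variable {E : Type*} [NormedAddCommGroup E] [InnerProductSpace ℝ E] [FiniteDimensional ℝ E]
  [MeasurableSpace E] [BorelSpace E]

/-- The Ornstein-Uhlenbeck (noise) operator with correlation `t`. -/
noncomputable def ouOp (t : ℝ) (f : E → ℝ) (x : E) : ℝ :=
  ∫ w, f (t • x + √(1 - t ^ 2) • w) ∂(stdGaussian E)

/-- All structural facts about the noise operator below (stationarity, symmetry, semigroup law) are
changes of variable by such a rotation of two independent Gaussians. -/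
lemma map_rotation_stdGaussian {t σ : ℝ} (h : t ^ 2 + σ ^ 2 = 1) :
    ((stdGaussian E).prod (stdGaussian E)).map
      (fun p ↦ (t • p.1 + σ • p.2, -σ • p.1 + t • p.2))
      = (stdGaussian E).prod (stdGaussian E) := by
  obtain ⟨θ, hc, hs⟩ : ∃ θ : ℝ, Real.cos θ = t ∧ Real.sin θ = σ := by
    set z : ℂ := ⟨t, σ⟩
    have hz : ‖z‖ = 1 := by
      rw [Complex.norm_def, Complex.normSq_apply]
      simp [z, ← pow_two, h]
    have hz0 : z ≠ 0 := by
      rintro h0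
      simp [h0] at hz
    exact ⟨z.arg, by rw [Complex.cos_arg hz0, hz]; simp [z], by rw [Complex.sin_arg, hz]; simp [z]⟩
  have := IsGaussian.map_rotation_eq_self (μ := stdGaussian E) (by simp) θ
  rw [← hc, ← hs]
  exact this

lemma lintegral_rotation_stdGaussian {t σ : ℝ} (h : t ^ 2 + σ ^ 2 = 1) {f : E × E → ℝ≥0∞}
    (hf : Measurable f) :
    ∫⁻ x, ∫⁻ w, f (t • x + σ • w, -σ • x + t • w) ∂(stdGaussian E) ∂(stdGaussian E) =
      ∫⁻ x, ∫⁻ w, f (x, w) ∂(stdGaussian E) ∂(stdGaussian E) := by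
  rw [lintegral_lintegral (f := fun x w ↦ f (t • x + σ • w, -σ • x + t • w))
    (Measurable.aemeasurable (by fun_prop)),
    lintegral_lintegral (f := fun x w ↦ f (x, w)) (by fun_prop)]
  conv_rhs => rw [← map_rotation_stdGaussian h]
  rw [lintegral_map (by fun_prop) (by fun_prop)]

lemma integrable_of_bounded {Ω : Type*} [MeasurableSpace Ω] {μ : Measure Ω} [IsFiniteMeasure μ]
    {f : Ω → ℝ} {C : ℝ} (hf : Measurable f) (hC : ∀ x, |f x| ≤ C) : Integrable f μ :=
  Integrable.of_bound hf.aestronglyMeasurable C (ae_of_all _ hC)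

lemma integral_rotation_stdGaussian {t σ C : ℝ} (h : t ^ 2 + σ ^ 2 = 1) {f : E × E → ℝ}
    (hf : Measurable f) (hC : ∀ p, |f p| ≤ C) :
    ∫ x, ∫ w, f (t • x + σ • w, -σ • x + t • w) ∂(stdGaussian E) ∂(stdGaussian E) =
      ∫ x, ∫ w, f (x, w) ∂(stdGaussian E) ∂(stdGaussian E) := by
  rw [integral_integral (f := fun x w ↦ f (t • x + σ • w, -σ • x + t • w))
    (integrable_of_bounded (by fun_prop) (fun p ↦ hC _)),
    integral_integral (f := fun x w ↦ f (x, w))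
    (integrable_of_bounded (by fun_prop) (fun p ↦ hC _))]
  conv_rhs => rw [← map_rotation_stdGaussian h]
  rw [integral_map (by fun_prop) hf.aestronglyMeasurable]

lemma integral_rotation_fst_stdGaussian {t σ C : ℝ} (h : t ^ 2 + σ ^ 2 = 1) {f : E → ℝ}
    (hf : Measurable f) (hC : ∀ p, |f p| ≤ C) :
    ∫ x, ∫ w, f (t • x + σ • w) ∂(stdGaussian E) ∂(stdGaussian E) = ∫ x, f x ∂(stdGaussian E) := by
  simpa using integral_rotation_stdGaussian (E := E) h (f := fun p ↦ f p.1) (by fun_prop)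
    (fun p ↦ hC p.1)

lemma measurable_ouOp {t : ℝ} {f : E → ℝ} (hf : Measurable f) : Measurable (ouOp t f) := by
  have : StronglyMeasurable (fun p : E × E ↦ f (t • p.1 + √(1 - t ^ 2) • p.2)) :=
    Measurable.stronglyMeasurable (by fun_prop)
  exact this.integral_prod_right'.measurable

lemma abs_ouOp_le {t C : ℝ} {f : E → ℝ} (hC : ∀ p, |f p| ≤ C) (x : E) : |ouOp t f x| ≤ C := by
  have := norm_integral_le_of_norm_le_const (μ := stdGaussian E) (C := C)
    (f := fun w ↦ f (t • x + √(1 - t ^ 2) • w)) (ae_of_all _ fun w ↦ hC _)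
  simpa [ouOp] using this

lemma one_sub_sq_nonneg {t : ℝ} (h0 : 0 ≤ t) (h1 : t ≤ 1) : 0 ≤ 1 - t ^ 2 := by nlinarith

/-- The semigroup property and the symmetry of the noise operator, as one identity. -/
lemma integral_ouOp_sq {t C : ℝ} (h0 : 0 ≤ t) (h1 : t ≤ 1) {f : E → ℝ}
    (hf : Measurable f) (hC : ∀ p, |f p| ≤ C) :
    ∫ x, ouOp t f x ^ 2 ∂(stdGaussian E) = ∫ x, f x * ouOp (t ^ 2) f x ∂(stdGaussian E) := by
  set σ := √(1 - t ^ 2) with hσ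
  have hσ2 : σ ^ 2 = 1 - t ^ 2 := Real.sq_sqrt (one_sub_sq_nonneg h0 h1)
  have hm := measurable_ouOp (t := t) hf
  have hb := abs_ouOp_le (t := t) hC
  have hC0 : 0 ≤ C := (abs_nonneg _).trans (hC 0)
  calc ∫ x, ouOp t f x ^ 2 ∂(stdGaussian E)
      = ∫ x, ∫ w, f (t • x + σ • w) * ouOp t f x ∂(stdGaussian E) ∂(stdGaussian E) := by
        refine integral_congr_ae (ae_of_all _ fun x ↦ ?_)
        simp only [integral_mul_const]
        rw [pow_two]
        rfl
    -- Symmetry: rotating (x, w) turns the noisy argument into a plain variable and moves the noise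
    -- to the other factor.
    _ = ∫ x, ∫ w, f x * ouOp t f (t • x + (-σ) • w) ∂(stdGaussian E) ∂(stdGaussian E) := by
        rw [← integral_rotation_stdGaussian (t := t) (σ := σ) (C := C * C) (by rw [hσ2]; ring)
          (f := fun p ↦ f p.1 * ouOp t f (t • p.1 + (-σ) • p.2))]
        · refine integral_congr_ae (ae_of_all _ fun x ↦ integral_congr_ae (ae_of_all _ fun w ↦ ?_))
          have : t • (t • x + σ • w) + (-σ) • (-σ • x + t • w) = (t ^ 2 + σ ^ 2) • x := by
            module
          simp only [this, hσ2]
          simp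
        · fun_prop
        · intro p
          rw [abs_mul]
          exact mul_le_mul (hC _) (hb _) (abs_nonneg _) hC0
    _ = ∫ x, f x * ouOp (t ^ 2) f x ∂(stdGaussian E) := by
        refine integral_congr_ae (ae_of_all _ fun x ↦ ?_)
        simp only [integral_const_mul]
        congr 1
        -- Semigroup law: the two noises −tσw and σy add up to one Gaussian of variance σ²(1 + t²) =
        -- 1 − t⁴. The rotation with coefficients −t/√(1+t²) and 1/√(1+t²) realizes this merging.
        have ht : 0 < 1 + t ^ 2 := by positivity
        have hr : √(1 + t ^ 2) ^ 2 = 1 + t ^ 2 := Real.sq_sqrt ht.le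
        have hr0 : 0 < √(1 + t ^ 2) := Real.sqrt_pos.2 ht
        have hs4 : √(1 - (t ^ 2) ^ 2) = σ * √(1 + t ^ 2) := by
          rw [hσ, ← Real.sqrt_mul (one_sub_sq_nonneg h0 h1)]
          congr 1; ring
        rw [ouOp, ← integral_rotation_fst_stdGaussian (t := -t / √(1 + t ^ 2))
          (σ := 1 / √(1 + t ^ 2)) (C := C) (by
            rw [div_pow, div_pow, hr]; field_simp; ring) (by fun_prop) (fun p ↦ hC _)]
        refine integral_congr_ae (ae_of_all _ fun y ↦ integral_congr_ae (ae_of_all _ fun w ↦ ?_))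
        simp only
        congr 1
        rw [hs4, smul_add, smul_smul, smul_smul, smul_add, smul_smul, smul_smul, add_assoc]
        congr 2
        · ring
        · congr 1; field_simp
        · congr 1; field_simp; exact hσ.symm

end OrnsteinUhlenbeck

/-! ### Taylor expansion of Mehler's kernel in the correlation. -/

section MehlerKernel

/-- Second order Taylor bound for the Mehler kernel at correlation `0`. -/
lemma abs_mehler_sub_taylor_le {n t q N : ℝ} (hn : 0 ≤ n) (h0 : 0 ≤ t) (h1 : t ≤ 1 / 2)
    (hq : |q| ≤ N / 2) :
    |Real.exp (-(n / 2) * Real.log (1 - t ^ 2) + (t * q - t ^ 2 * N / 2) / (1 - t ^ 2))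
        - (1 + t * q + t ^ 2 * ((n - N) / 2 + q ^ 2 / 2))|
      ≤ 12 * t ^ 3 * (1 + n + N) ^ 3 * Real.exp (2 * t * (1 + n + N)) := by
  set θ := -(n / 2) * Real.log (1 - t ^ 2) + (t * q - t ^ 2 * N / 2) / (1 - t ^ 2) with hθ
  set U := 1 + n + N with hU
  have hN : 0 ≤ N := by linarith [abs_nonneg q]
  have hU1 : 1 ≤ U := by linarith
  have ht2 : t ^ 2 ≤ 1 / 4 := by nlinarith
  have ht20 : 0 ≤ t ^ 2 := sq_nonneg t
  have ht3 : 0 ≤ t ^ 3 := pow_nonneg h0 3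
  have ht32 : t ^ 3 ≤ t ^ 2 / 2 := by nlinarith
  have hq' := abs_le.1 hq
  have hlog : |Real.log (1 - t ^ 2) + t ^ 2| ≤ 2 * t ^ 3 := by
    have := Real.abs_log_sub_add_sum_range_le (x := t ^ 2) (by rw [abs_of_nonneg ht20]; linarith) 1
    simp only [Finset.range_one, Finset.sum_singleton, zero_add, pow_one, Nat.cast_zero, div_one,
      abs_of_nonneg ht20] at this
    rw [add_comm]
    refine this.trans ?_
    rw [div_le_iff₀ (by linarith)]
    have h4 := mul_le_mul_of_nonneg_left h1 ht3
    have h5 := mul_le_mul_of_nonneg_left ht2 ht3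
    have h6 : (t ^ 2) ^ (1 + 1) = t ^ 3 * t := by ring
    rw [h6]
    linarith
  -- The exponent is expanded to second order with error e = O(t³U), and only then is exp expanded
  -- to second order in θ.
  set e := θ - (t * q + t ^ 2 * ((n - N) / 2)) with he
  have hfrac : |(t * q - t ^ 2 * N / 2) / (1 - t ^ 2) - (t * q - t ^ 2 * N / 2)| ≤ t ^ 3 * N := by
    have h34 : 0 < 1 - t ^ 2 := by linarith
    have : (t * q - t ^ 2 * N / 2) / (1 - t ^ 2) - (t * q - t ^ 2 * N / 2)
        = t ^ 3 * ((q - t * N / 2) / (1 - t ^ 2)) := by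
      field_simp; ring
    rw [this, abs_mul, abs_of_nonneg ht3]
    refine mul_le_mul_of_nonneg_left ?_ ht3
    have h4 := mul_le_mul_of_nonneg_left ht2 hN
    have h5 := mul_le_mul_of_nonneg_right h1 hN
    have h6 := mul_nonneg h0 hN
    rw [abs_div, abs_of_pos h34, div_le_iff₀ h34, abs_le]
    constructor <;> linarith
  have he_le : |e| ≤ t ^ 3 * U := by
    have : e = -(n / 2) * (Real.log (1 - t ^ 2) + t ^ 2) +
        ((t * q - t ^ 2 * N / 2) / (1 - t ^ 2) - (t * q - t ^ 2 * N / 2)) := by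
      rw [he, hθ]; ring
    rw [this]
    refine (abs_add_le _ _).trans ?_
    rw [abs_mul, abs_neg, abs_of_nonneg (by linarith : 0 ≤ n / 2)]
    have h4 := mul_le_mul_of_nonneg_left hlog (by linarith : 0 ≤ n / 2)
    have h5 : t ^ 3 * U = t ^ 3 + n / 2 * (2 * t ^ 3) + t ^ 3 * N := by rw [hU]; ring
    linarith
  have hθq : |θ - t * q| ≤ 2 * t ^ 2 * U := by
    have : θ - t * q = t ^ 2 * ((n - N) / 2) + e := by rw [he]; ring
    rw [this]
    refine (abs_add_le _ _).trans ?_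
    rw [abs_mul, abs_of_nonneg ht20]
    have h4 : |(n - N) / 2| ≤ U := by rw [abs_le]; constructor <;> linarith
    have h5 := mul_le_mul_of_nonneg_left h4 ht20
    have h6 := mul_le_mul_of_nonneg_right ht32 (zero_le_one.trans hU1)
    have h7 := mul_nonneg ht20 (zero_le_one.trans hU1)
    linarith
  have htq : |t * q| ≤ t * U / 2 := by
    rw [abs_mul, abs_of_nonneg h0]
    have := mul_le_mul_of_nonneg_left (by linarith : |q| ≤ U / 2) h0
    linarith
  have htU : 0 ≤ t * U := mul_nonneg h0 (zero_le_one.trans hU1)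
  have ht2U : t ^ 2 * U ≤ t * U / 2 := by
    have := mul_le_mul_of_nonneg_right h1 htU
    have h4 : t ^ 2 * U = t * (t * U) := by ring
    linarith
  have hθ_le : |θ| ≤ 2 * t * U := by
    have : θ = (θ - t * q) + t * q := by ring
    rw [this]
    refine (abs_add_le _ _).trans ?_
    linarith
  have hθq' : |θ + t * q| ≤ 3 * t * U := by
    refine (abs_add_le _ _).trans ?_
    linarith
  have hexp : |Real.exp θ - (1 + θ + θ ^ 2 / 2)| ≤ 8 * t ^ 3 * U ^ 3 * Real.exp (2 * t * U) := by
    have := Complex.norm_exp_sub_sum_le_norm_mul_exp (θ : ℂ) 3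
    have h2 : Complex.exp (θ : ℂ) - ∑ m ∈ Finset.range 3, (θ : ℂ) ^ m / (m.factorial : ℂ)
        = ((Real.exp θ - (1 + θ + θ ^ 2 / 2) : ℝ) : ℂ) := by
      simp [Finset.sum_range_succ, Nat.factorial]
    rw [h2, Complex.norm_real, Complex.norm_real, Real.norm_eq_abs, Real.norm_eq_abs] at this
    refine this.trans ?_
    have h3 : |θ| ^ 3 ≤ (2 * t * U) ^ 3 := pow_le_pow_left₀ (abs_nonneg _) hθ_le 3
    have h4 : Real.exp |θ| ≤ Real.exp (2 * t * U) := Real.exp_le_exp.2 hθ_le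
    calc |θ| ^ 3 * Real.exp |θ| ≤ (2 * t * U) ^ 3 * Real.exp (2 * t * U) := by gcongr
      _ = _ := by ring
  have hsq : |θ ^ 2 / 2 - (t * q) ^ 2 / 2| ≤ 3 * t ^ 3 * U ^ 2 := by
    have : θ ^ 2 / 2 - (t * q) ^ 2 / 2 = (θ - t * q) * (θ + t * q) / 2 := by ring
    rw [this, abs_div, abs_mul, abs_two]
    have := mul_le_mul hθq hθq' (abs_nonneg _) (by positivity)
    linarith
  have hE : 1 ≤ Real.exp (2 * t * U) := Real.one_le_exp (by positivity)
  have hsplit : Real.exp θ - (1 + t * q + t ^ 2 * ((n - N) / 2 + q ^ 2 / 2))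
      = (Real.exp θ - (1 + θ + θ ^ 2 / 2)) + (θ ^ 2 / 2 - (t * q) ^ 2 / 2) + e := by
    rw [he]; ring
  rw [hsplit]
  refine (abs_add_three _ _ _).trans ?_
  have hU3 : t ^ 3 * U ≤ t ^ 3 * U ^ 3 := 
    mul_le_mul_of_nonneg_left (le_self_pow₀ hU1 (by norm_num)) ht3
  have hU23 : t ^ 3 * U ^ 2 ≤ t ^ 3 * U ^ 3 := 
    mul_le_mul_of_nonneg_left (pow_le_pow_right₀ hU1 (by norm_num)) ht3
  have h5 : t ^ 3 * U ^ 3 ≤ t ^ 3 * U ^ 3 * Real.exp (2 * t * U) :=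
    le_mul_of_one_le_right (by positivity) hE
  linarith

/-- The remainder of the Mehler kernel with Gaussian growth. -/
lemma exists_abs_mehler_sub_taylor_le {n b : ℝ} (hn : 0 ≤ n) (hb : 0 < b) :
    ∃ C t₀ : ℝ, 0 < t₀ ∧ t₀ ≤ 1 / 2 ∧ ∀ t q N : ℝ, 0 ≤ t → t ≤ t₀ → |q| ≤ N / 2 →
    |Real.exp (-(n / 2) * Real.log (1 - t ^ 2) + (t * q - t ^ 2 * N / 2) / (1 - t ^ 2))
        - (1 + t * q + t ^ 2 * ((n - N) / 2 + q ^ 2 / 2))| ≤ t ^ 3 * (C * Real.exp (b * N)) := by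
  -- Half of the allowed growth e^{bU} pays for U³ through the cubic term of the exponential series,
  -- and the other half for e^{2tU}, whence t ≤ b/4.
  refine ⟨12 * (6 / (b / 2) ^ 3) * Real.exp (b * (1 + n)), min (1 / 2) (b / 4), by positivity,
    min_le_left _ _, fun t q N h0 h1 hq ↦ ?_⟩
  have hN : 0 ≤ N := by linarith [abs_nonneg q]
  refine (abs_mehler_sub_taylor_le hn h0 (h1.trans (min_le_left _ _)) hq).trans ?_
  set U := 1 + n + N with hU
  have hU0 : 0 ≤ U := by linarith
  have h3 : U ^ 3 ≤ 6 / (b / 2) ^ 3 * Real.exp (b / 2 * U) := by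
    have := Real.pow_div_factorial_le_exp (b / 2 * U) (by positivity) 3
    rw [div_mul_eq_mul_div, le_div_iff₀ (by positivity)]
    simp only [Nat.factorial] at this
    push_cast at this
    rw [div_le_iff₀ (by norm_num)] at this
    rw [mul_pow] at this
    linarith
  have h2 : Real.exp (2 * t * U) ≤ Real.exp (b / 2 * U) := by
    have := h1.trans (min_le_right _ _)
    gcongr
    linarith
  calc 12 * t ^ 3 * U ^ 3 * Real.exp (2 * t * U)
      ≤ 12 * t ^ 3 * (6 / (b / 2) ^ 3 * Real.exp (b / 2 * U)) * Real.exp (b / 2 * U) := by gcongr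
    _ = t ^ 3 * (12 * (6 / (b / 2) ^ 3) * (Real.exp (b / 2 * U) * Real.exp (b / 2 * U))) := by ring
    _ = t ^ 3 * (12 * (6 / (b / 2) ^ 3) * Real.exp (b * (1 + n)) * Real.exp (b * N)) := by
      rw [← Real.exp_add, mul_assoc (12 * (6 / (b / 2) ^ 3)), ← Real.exp_add, hU]
      ring_nf

end MehlerKernel

/-! ### Gaussian density and Mehler's formula. -/

section Density

set_option linter.unusedSectionVars false

variable {E : Type*} [NormedAddCommGroup E] [InnerProductSpace ℝ E] [FiniteDimensional ℝ E]
  [MeasurableSpace E] [BorelSpace E]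

/-- The density of the standard Gaussian measure. -/
noncomputable def stdGaussianPDF (E : Type*) [NormedAddCommGroup E] [InnerProductSpace ℝ E]
    (x : E) : ℝ :=
  (2 * Real.pi) ^ (-(Module.finrank ℝ E / 2 : ℝ)) * Real.exp (-‖x‖ ^ 2 / 2)

lemma stdGaussianPDF_pos (x : E) : 0 < stdGaussianPDF E x := by
  unfold stdGaussianPDF; positivity

lemma measurable_stdGaussianPDF : Measurable (stdGaussianPDF E) := by
  unfold stdGaussianPDF; fun_prop

lemma integral_stdGaussianPDF : ∫ x, stdGaussianPDF E x = 1 := by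
  have := GaussianFourier.integral_rexp_neg_mul_sq_norm (V := E) (b := 1 / 2) (by norm_num)
  simp only [stdGaussianPDF, integral_const_mul]
  have h2 : ∀ x : E, -‖x‖ ^ 2 / 2 = -(1 / 2) * ‖x‖ ^ 2 := fun x ↦ by ring
  simp only [h2, this]
  rw [Real.rpow_neg (by positivity)]
  have : Real.pi / (1 / 2) = 2 * Real.pi := by ring
  rw [this, inv_mul_cancel₀ (by positivity)]

lemma integrable_stdGaussianPDF : Integrable (stdGaussianPDF E) :=
  Integrable.of_integral_ne_zero (by rw [integral_stdGaussianPDF]; norm_num)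

/-- Both sides have the same characteristic function, by the Gaussian Fourier integral. -/
lemma stdGaussian_eq_withDensity :
    stdGaussian E = volume.withDensity (fun x ↦ ENNReal.ofReal (stdGaussianPDF E x)) := by
  have : IsProbabilityMeasure
      ((volume : Measure E).withDensity (fun x ↦ ENNReal.ofReal (stdGaussianPDF E x))) := by
    constructor
    rw [withDensity_apply _ MeasurableSet.univ, Measure.restrict_univ,
      ← ofReal_integral_eq_lintegral_ofReal integrable_stdGaussianPDF
        (ae_of_all _ fun x ↦ (stdGaussianPDF_pos x).le), integral_stdGaussianPDF]
    simp
  refine Measure.ext_of_charFun ?_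
  ext t
  rw [charFun_stdGaussian, charFun_apply, integral_withDensity_eq_integral_toReal_smul
    (measurable_stdGaussianPDF.ennreal_ofReal) (by simp)]
  have := GaussianFourier.integral_cexp_neg_mul_sq_norm_add (V := E) (b := 1 / 2) (by norm_num)
    Complex.I t
  have h3 : ∀ x : E, (ENNReal.ofReal (stdGaussianPDF E x)).toReal •
      Complex.exp ((inner ℝ x t : ℝ) * Complex.I)
      = (((2 * Real.pi) ^ (-(Module.finrank ℝ E / 2 : ℝ)) : ℝ) : ℂ) *
        Complex.exp (-(1 / 2) * ‖x‖ ^ 2 + Complex.I * (inner ℝ t x : ℝ)) := by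
    intro x
    rw [ENNReal.toReal_ofReal (stdGaussianPDF_pos x).le, stdGaussianPDF, Complex.real_smul,
      Complex.exp_add, real_inner_comm]
    push_cast
    rw [mul_assoc]
    congr 3
    · ring
    · ring_nf
  simp only [h3, integral_const_mul, this]
  rw [← mul_assoc]
  have h4 : (((2 * Real.pi) ^ (-(Module.finrank ℝ E / 2 : ℝ)) : ℝ) : ℂ) *
      ((Real.pi : ℂ) / (1 / 2)) ^ ((Module.finrank ℝ E : ℂ) / 2) = 1 := by
    have : ((Real.pi : ℂ) / (1 / 2)) ^ ((Module.finrank ℝ E : ℂ) / 2)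
        = (((2 * Real.pi) ^ ((Module.finrank ℝ E / 2 : ℝ)) : ℝ) : ℂ) := by
      rw [Complex.ofReal_cpow (by positivity)]
      push_cast
      congr 1
      ring
    rw [this, ← Complex.ofReal_mul, ← Real.rpow_add (by positivity)]
    simp
  rw [h4, one_mul]
  congr 1
  rw [Complex.I_sq]
  ring

lemma integral_stdGaussian_eq (f : E → ℝ) :
    ∫ x, f x ∂(stdGaussian E) = ∫ x, stdGaussianPDF E x * f x := by
  rw [stdGaussian_eq_withDensity, integral_withDensity_eq_integral_toReal_smul
    (measurable_stdGaussianPDF.ennreal_ofReal) (by simp)]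
  refine integral_congr_ae (ae_of_all _ fun x ↦ ?_)
  simp [ENNReal.toReal_ofReal (stdGaussianPDF_pos x).le]

/-- Mehler's formula. -/
lemma ouOp_eq_integral_mehler {t : ℝ} (h0 : 0 ≤ t) (h1 : t < 1) (f : E → ℝ) (x : E) :
    ouOp t f x = ∫ y, f y * Real.exp (-(Module.finrank ℝ E / 2 : ℝ) * Real.log (1 - t ^ 2) +
      (t * inner ℝ x y - t ^ 2 * (‖x‖ ^ 2 + ‖y‖ ^ 2) / 2) / (1 - t ^ 2)) ∂(stdGaussian E) := by
  set σ := √(1 - t ^ 2) with hσ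
  have hp : 0 < 1 - t ^ 2 := by nlinarith
  have hσ2 : σ ^ 2 = 1 - t ^ 2 := Real.sq_sqrt hp.le
  have hσ0 : 0 < σ := Real.sqrt_pos.2 hp
  rw [ouOp, integral_stdGaussian_eq, integral_stdGaussian_eq]
  set k : E → ℝ := fun y ↦ stdGaussianPDF E (σ⁻¹ • (y - t • x)) * f y with hk
  have h2 : ∀ w : E, stdGaussianPDF E w * f (t • x + σ • w) = k (t • x + σ • w) := by
    intro w
    simp [hk, smul_smul, inv_mul_cancel₀ hσ0.ne']
  rw [← hσ]
  simp_rw [h2]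
  rw [Measure.integral_comp_smul volume (fun y ↦ k (t • x + y)) σ, integral_add_left_eq_self,
    smul_eq_mul, ← integral_const_mul]
  refine integral_congr_ae (ae_of_all _ fun y ↦ ?_)
  simp only [hk, stdGaussianPDF]
  have h4 : |(σ ^ Module.finrank ℝ E)⁻¹|
      = Real.exp (-(Module.finrank ℝ E / 2 : ℝ) * Real.log (1 - t ^ 2)) := by
    rw [abs_of_pos (by positivity), ← hσ2, Real.log_pow]
    push_cast
    rw [show -((Module.finrank ℝ E : ℝ) / 2) * (2 * Real.log σ)
      = -((Module.finrank ℝ E : ℝ) * Real.log σ) by ring, Real.exp_neg, ← Real.log_pow,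
      Real.exp_log (by positivity)]
  have h5 : ‖σ⁻¹ • (y - t • x)‖ ^ 2
      = (‖y‖ ^ 2 - 2 * t * inner ℝ x y + t ^ 2 * ‖x‖ ^ 2) / (1 - t ^ 2) := by
    rw [norm_smul, mul_pow, norm_sub_sq_real, inner_smul_right, norm_smul, real_inner_comm,
      Real.norm_eq_abs, Real.norm_eq_abs, sq_abs, mul_pow, sq_abs, inv_pow, hσ2]
    ring
  rw [h4, h5, Real.exp_add]
  have h6 : Real.exp (-((‖y‖ ^ 2 - 2 * t * inner ℝ x y + t ^ 2 * ‖x‖ ^ 2) / (1 - t ^ 2)) / 2)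
      = Real.exp (-‖y‖ ^ 2 / 2) *
        Real.exp ((t * inner ℝ x y - t ^ 2 * (‖x‖ ^ 2 + ‖y‖ ^ 2) / 2) / (1 - t ^ 2)) := by
    rw [← Real.exp_add]
    congr 1
    field_simp
    ring
  rw [h6]
  ring

end Density

/-! ### Third-order decay on the orthogonal complement of quadratic polynomials. -/

section SpectralGap

variable {E : Type*} [NormedAddCommGroup E] [InnerProductSpace ℝ E] [FiniteDimensional ℝ E]
  [MeasurableSpace E] [BorelSpace E]

/-- `f` is orthogonal to the polynomials of degree at most two in `L²` of the standard Gaussian. -/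
structure OrthQuadratic (f : E → ℝ) : Prop where
  zero : ∫ x, f x ∂(stdGaussian E) = 0
  one : ∀ v : E, ∫ x, f x * inner ℝ v x ∂(stdGaussian E) = 0
  two : ∀ v : E, ∫ x, f x * inner ℝ v x ^ 2 ∂(stdGaussian E) = 0

lemma integrable_inner_stdGaussian (v : E) : Integrable (fun x ↦ inner ℝ v x) (stdGaussian E) :=
  (IsGaussian.integrable_id (μ := stdGaussian E)).const_inner v

lemma integrable_inner_sq_stdGaussian (v : E) :
    Integrable (fun x ↦ inner ℝ v x ^ 2) (stdGaussian E) := by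
  have := (IsGaussian.memLp_two_id (μ := stdGaussian E)).const_inner (𝕜 := ℝ) v
  exact this.integrable_sq

lemma Integrable.bounded_mul {Ω : Type*} [MeasurableSpace Ω] {μ : Measure Ω}
    {f g : Ω → ℝ} {C : ℝ} (hg : Integrable g μ) (hf : Measurable f) (hC : ∀ x, |f x| ≤ C) :
    Integrable (fun x ↦ f x * g x) μ :=
  hg.bdd_mul hf.aestronglyMeasurable (ae_of_all _ hC)

namespace OrthQuadratic

variable {f : E → ℝ} {C : ℝ}

lemma integral_mul_norm_sq (h : OrthQuadratic f) (hf : Measurable f) (hC : ∀ x, |f x| ≤ C) :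
    ∫ x, f x * ‖x‖ ^ 2 ∂(stdGaussian E) = 0 := by
  have : ∀ x, f x * ‖x‖ ^ 2 = ∑ i, f x * inner ℝ (stdOrthonormalBasis ℝ E i) x ^ 2 := by
    intro x
    rw [← Finset.mul_sum, OrthonormalBasis.sum_sq_inner_right]
  simp_rw [this]
  rw [integral_finsetSum]
  · simp [h.two]
  · exact fun i _ ↦ Integrable.bounded_mul (integrable_inner_sq_stdGaussian _) hf hC

/-- For fixed x the Taylor polynomial of the kernel has degree at most two in y, so it is invisible
to f; only the O(t³) remainder contributes to P_t f. -/
lemma integral_mul_taylor (h : OrthQuadratic f) (hf : Measurable f) (hC : ∀ x, |f x| ≤ C)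
    (t n : ℝ) (x : E) :
    Integrable (fun y ↦ f y * (1 + t * inner ℝ x y + t ^ 2 * ((n - (‖x‖ ^ 2 + ‖y‖ ^ 2)) / 2
      + inner ℝ x y ^ 2 / 2))) (stdGaussian E) ∧
    ∫ y, f y * (1 + t * inner ℝ x y + t ^ 2 * ((n - (‖x‖ ^ 2 + ‖y‖ ^ 2)) / 2
      + inner ℝ x y ^ 2 / 2)) ∂(stdGaussian E) = 0 := by
  have hsq : Integrable (fun y : E ↦ ‖y‖ ^ 2) (stdGaussian E) :=
    (IsGaussian.memLp_two_id (μ := stdGaussian E)).integrable_norm_pow (by norm_num)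
  have i0 : Integrable (fun y ↦ (1 + t ^ 2 * (n - ‖x‖ ^ 2) / 2) * f y) (stdGaussian E) :=
    (integrable_of_bounded hf hC).const_mul _
  have i1 : Integrable (fun y ↦ t * (f y * inner ℝ x y)) (stdGaussian E) :=
    (Integrable.bounded_mul (integrable_inner_stdGaussian _) hf hC).const_mul _
  have i2 : Integrable (fun y ↦ (-t ^ 2 / 2) * (f y * ‖y‖ ^ 2)) (stdGaussian E) :=
    (Integrable.bounded_mul hsq hf hC).const_mul _
  have i3 : Integrable (fun y ↦ (t ^ 2 / 2) * (f y * inner ℝ x y ^ 2)) (stdGaussian E) :=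
    (Integrable.bounded_mul (integrable_inner_sq_stdGaussian _) hf hC).const_mul _
  have e : (fun y ↦ f y * (1 + t * inner ℝ x y + t ^ 2 * ((n - (‖x‖ ^ 2 + ‖y‖ ^ 2)) / 2
      + inner ℝ x y ^ 2 / 2))) = fun y ↦ (1 + t ^ 2 * (n - ‖x‖ ^ 2) / 2) * f y
        + t * (f y * inner ℝ x y) + (-t ^ 2 / 2) * (f y * ‖y‖ ^ 2)
        + (t ^ 2 / 2) * (f y * inner ℝ x y ^ 2) := by
    ext y; ring
  rw [e]
  refine ⟨((i0.add i1).add i2).add i3, ?_⟩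
  rw [integral_add ((i0.fun_add i1).fun_add i2) i3, integral_add (i0.fun_add i1) i2,
    integral_add i0 i1]
  simp only [integral_const_mul, h.zero, h.one, h.two, h.integral_mul_norm_sq hf hC]
  simp

/-- Functions orthogonal to quadratic polynomials are damped to third order by the noise. -/
lemma exists_integral_mul_ouOp_le (h : OrthQuadratic f) (hf : Measurable f)
    (hC : ∀ x, |f x| ≤ C) :
    ∃ B t₀ : ℝ, 0 < t₀ ∧ ∀ t, 0 ≤ t → t ≤ t₀ →
      ∫ x, f x * ouOp t f x ∂(stdGaussian E) ≤ B * t ^ 3 := by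
  -- Fernique's theorem supplies the exponent b that the kernel remainder is allowed to grow with.
  obtain ⟨b, hb, hint⟩ := IsGaussian.exists_integrable_exp_sq (stdGaussian E)
  obtain ⟨A, t₀, ht₀, ht₀', hA⟩ := exists_abs_mehler_sub_taylor_le
    (n := (Module.finrank ℝ E : ℝ)) (by positivity) hb
  set I := ∫ x, Real.exp (b * ‖x‖ ^ 2) ∂(stdGaussian E) with hI
  have hC0 : 0 ≤ C := (abs_nonneg _).trans (hC 0)
  refine ⟨C * (C * (A * I)) * I, t₀, ht₀, fun t h0 h1 ↦ ?_⟩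
  have key : ∀ x, |ouOp t f x| ≤ C * (t ^ 3 * (A * I)) * Real.exp (b * ‖x‖ ^ 2) := by
    intro x
    obtain ⟨hi, hz⟩ := h.integral_mul_taylor hf hC t (Module.finrank ℝ E : ℝ) x
    set p : E → ℝ := fun y ↦ (1 + t * inner ℝ x y + t ^ 2 *
      (((Module.finrank ℝ E : ℝ) - (‖x‖ ^ 2 + ‖y‖ ^ 2)) / 2 + inner ℝ x y ^ 2 / 2)) with hp
    set M : E → ℝ := fun y ↦ Real.exp (-(Module.finrank ℝ E / 2 : ℝ) * Real.log (1 - t ^ 2) +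
      (t * inner ℝ x y - t ^ 2 * (‖x‖ ^ 2 + ‖y‖ ^ 2) / 2) / (1 - t ^ 2)) with hM
    have hbound : ∀ y, ‖f y * (M y - p y)‖
        ≤ C * (t ^ 3 * (A * Real.exp (b * ‖x‖ ^ 2))) * Real.exp (b * ‖y‖ ^ 2) := by
      intro y
      have := hA t (inner ℝ x y) (‖x‖ ^ 2 + ‖y‖ ^ 2) h0 h1 (by
        refine (abs_real_inner_le_norm x y).trans ?_
        nlinarith [sq_nonneg (‖x‖ - ‖y‖)])
      rw [norm_mul, Real.norm_eq_abs, Real.norm_eq_abs]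
      calc |f y| * |M y - p y| ≤ C * (t ^ 3 * (A * Real.exp (b * (‖x‖ ^ 2 + ‖y‖ ^ 2)))) :=
            mul_le_mul (hC y) this (abs_nonneg _) hC0
        _ = _ := by rw [mul_add, Real.exp_add]; ring
    have hd : Integrable (fun y ↦ f y * (M y - p y)) (stdGaussian E) :=
      (hint.const_mul _).mono' (by
        refine Measurable.aestronglyMeasurable ?_
        simp only [hM, hp]
        fun_prop) (ae_of_all _ hbound)
    have e : ouOp t f x = ∫ y, f y * (M y - p y) ∂(stdGaussian E) := by
      rw [ouOp_eq_integral_mehler h0 (by linarith)]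
      have : (fun y ↦ f y * M y) = fun y ↦ f y * (M y - p y) + f y * p y := by ext y; ring
      change ∫ y, f y * M y ∂(stdGaussian E) = _
      rw [this, integral_add hd hi, hz, add_zero]
    rw [e, ← Real.norm_eq_abs]
    refine (norm_integral_le_of_norm_le (hint.const_mul _) (ae_of_all _ hbound)).trans ?_
    rw [integral_const_mul, ← hI]
    apply le_of_eq; ring
  have := norm_integral_le_of_norm_le (μ := stdGaussian E)
    (f := fun x ↦ f x * ouOp t f x)
    (g := fun x ↦ C * (C * (t ^ 3 * (A * I))) * Real.exp (b * ‖x‖ ^ 2))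
    (hint.const_mul _) (ae_of_all _ fun x ↦ by
      rw [norm_mul, Real.norm_eq_abs, Real.norm_eq_abs]
      calc |f x| * |ouOp t f x| ≤ C * (C * (t ^ 3 * (A * I)) * Real.exp (b * ‖x‖ ^ 2)) :=
          mul_le_mul (hC x) (key x) (abs_nonneg _) hC0
        _ = _ := by ring)
  refine (le_abs_self _).trans (this.trans (le_of_eq ?_))
  rw [integral_const_mul, ← hI]
  ring

end OrthQuadratic

lemma sq_integral_mul_le {Ω : Type*} [MeasurableSpace Ω] {μ : Measure Ω} {f g : Ω → ℝ}
    (hf : MemLp f 2 μ) (hg : MemLp g 2 μ) :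
    (∫ x, f x * g x ∂μ) ^ 2 ≤ (∫ x, f x ^ 2 ∂μ) * ∫ x, g x ^ 2 ∂μ := by
  have hff := hf.integrable_sq
  have hgg := hg.integrable_sq
  have hfg : Integrable (fun x ↦ f x * g x) μ := hf.integrable_mul hg
  have := discrim_le_zero (a := ∫ x, f x ^ 2 ∂μ) (b := 2 * ∫ x, f x * g x ∂μ)
    (c := ∫ x, g x ^ 2 ∂μ) (fun r ↦ by
      have e : ∀ x, (r * f x + g x) ^ 2 = r * r * f x ^ 2 + r * 2 * (f x * g x) + g x ^ 2 :=
        fun x ↦ by ring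
      have h0 : 0 ≤ ∫ x, (r * f x + g x) ^ 2 ∂μ := integral_nonneg fun x ↦ sq_nonneg _
      simp_rw [e] at h0
      rw [integral_add ((hff.const_mul _).fun_add (hfg.const_mul _)) hgg,
        integral_add (hff.const_mul _) (hfg.const_mul _), integral_const_mul,
        integral_const_mul] at h0
      linarith)
  rw [discrim] at this
  linarith

lemma memLp_two_of_bounded {Ω : Type*} [MeasurableSpace Ω] {μ : Measure Ω} [IsFiniteMeasure μ]
    {f : Ω → ℝ} {C : ℝ} (hf : Measurable f) (hC : ∀ x, |f x| ≤ C) : MemLp f 2 μ :=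
  MemLp.of_bound hf.aestronglyMeasurable C (ae_of_all _ hC)

/-- The noise operator contracts functions orthogonal to quadratic polynomials by `ρ³` in `L²`. -/
lemma OrthQuadratic.integral_ouOp_sq_le {f : E → ℝ} {C ρ : ℝ} (h : OrthQuadratic f)
    (hf : Measurable f) (hC : ∀ x, |f x| ≤ C) (h0 : 0 < ρ) (h1 : ρ < 1) :
    ∫ x, ouOp ρ f x ^ 2 ∂(stdGaussian E) ≤ ρ ^ 6 * ∫ x, f x ^ 2 ∂(stdGaussian E) := by
  set A := ∫ x, f x ^ 2 ∂(stdGaussian E) with hA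
  set a : ℝ → ℝ := fun t ↦ ∫ x, f x * ouOp t f x ∂(stdGaussian E) with ha
  obtain ⟨B, t₀, ht₀, hB⟩ := h.exists_integral_mul_ouOp_le hf hC
  have hA0 : 0 ≤ A := integral_nonneg fun x ↦ sq_nonneg _
  -- Cauchy-Schwarz together with ‖P_t f‖² = ⟨f, P_{t²} f⟩.
  have step : ∀ t, 0 ≤ t → t ≤ 1 → a t ^ 2 ≤ A * a (t ^ 2) := by
    intro t h0 h1
    have := sq_integral_mul_le (μ := stdGaussian E) (memLp_two_of_bounded hf hC)
      (memLp_two_of_bounded (measurable_ouOp (t := t) hf) (abs_ouOp_le hC))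
    rwa [integral_ouOp_sq h0 h1 hf hC] at this
  rw [integral_ouOp_sq h0.le h1.le hf hC]
  change a (ρ ^ 2) ≤ _
  set x := ρ ^ 2 with hx
  have hx0 : 0 < x := by positivity
  have hx1 : x < 1 := by rw [hx]; nlinarith
  have hxx : ρ ^ 6 = x ^ 3 := by rw [hx]; ring
  rw [hxx]
  by_contra! hlt
  rcases hA0.eq_or_lt with hAz | hAp
  · have := step x hx0.le hx1.le
    rw [← hAz] at this hlt
    nlinarith
  have hpos : 0 < a x := lt_of_le_of_lt (by positivity) hlt
  -- R measures by how much the claim fails at x. Each squaring of the correlation squares this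
  -- excess, which ends up incompatible with a t ≤ B t³.
  set R := a x / (x ^ 3 * A) with hR
  have hR1 : 1 < R := by rw [hR, lt_div_iff₀ (by positivity)]; linarith
  have iter : ∀ k : ℕ, R ^ 2 ^ k * ((x ^ 2 ^ k) ^ 3 * A) ≤ a (x ^ 2 ^ k) := by
    intro k
    induction k with
    | zero =>
      simp only [pow_zero, pow_one]
      rw [hR, div_mul_cancel₀ _ (by positivity)]
    | succ k ih =>
      have h3 := step (x ^ 2 ^ k) (by positivity) (pow_le_one₀ hx0.le hx1.le)
      have h4 : (R ^ 2 ^ k * ((x ^ 2 ^ k) ^ 3 * A)) ^ 2 ≤ A * a ((x ^ 2 ^ k) ^ 2) :=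
        (pow_le_pow_left₀ (by positivity) ih 2).trans h3
      have h5 : (R ^ 2 ^ k * ((x ^ 2 ^ k) ^ 3 * A)) ^ 2
          = A * (R ^ 2 ^ (k + 1) * ((x ^ 2 ^ (k + 1)) ^ 3 * A)) := by
        rw [pow_succ 2 k, pow_mul, pow_mul]
        ring
      rw [h5, ← pow_mul x (2 ^ k) 2, ← pow_succ] at h4
      exact le_of_mul_le_mul_left h4 hAp
  have hexp : Filter.Tendsto (fun k : ℕ ↦ 2 ^ k) Filter.atTop Filter.atTop :=
    tendsto_pow_atTop_atTop_of_one_lt (by norm_num)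
  have t1 : Filter.Tendsto (fun k : ℕ ↦ R ^ 2 ^ k) Filter.atTop Filter.atTop :=
    (tendsto_pow_atTop_atTop_of_one_lt hR1).comp hexp
  have t2 : Filter.Tendsto (fun k : ℕ ↦ x ^ 2 ^ k) Filter.atTop (nhds 0) :=
    (tendsto_pow_atTop_nhds_zero_of_lt_one hx0.le hx1).comp hexp
  -- For large k the excess R^(2^k) passes B / A while the correlation x^(2^k) is already in the
  -- range of the cubic bound.
  obtain ⟨k, hk1, hk2⟩ := ((t1.eventually_gt_atTop (B / A)).and
    (t2.eventually (Iic_mem_nhds ht₀))).exists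
  have h6 := (iter k).trans (hB _ (by positivity) hk2)
  have h7 : R ^ 2 ^ k * A ≤ B := by
    have : 0 < (x ^ 2 ^ k) ^ 3 := by positivity
    refine le_of_mul_le_mul_right ?_ this
    linarith
  rw [div_lt_iff₀ hAp] at hk1
  linarith

end SpectralGap

/-! ### Gain of Gaussian weight under noise. -/

section WeightedBound

set_option linter.unusedSectionVars false

variable {E : Type*} [NormedAddCommGroup E] [InnerProductSpace ℝ E] [FiniteDimensional ℝ E]
  [MeasurableSpace E] [BorelSpace E]

lemma norm_sq_smul_add_le {ρ σ : ℝ} (h : ρ ^ 2 + σ ^ 2 = 1) (x w : E) :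
    ‖ρ • x + σ • w‖ ^ 2 ≤ (1 + ρ ^ 2) / 2 * ‖x‖ ^ 2 + (1 + ρ ^ 2) * ‖w‖ ^ 2 := by
  -- Young's inequality with weights chosen so that the coefficient of ‖x‖² becomes (1 + ρ²)/2 < 1;
  -- this deficit is the source of the gained decay.
  have h1 : 0 ≤ ‖σ • x - (2 * ρ) • w‖ ^ 2 := sq_nonneg _
  rw [norm_sub_sq_real, norm_smul, norm_smul, mul_pow, mul_pow, inner_smul_left, inner_smul_right,
    Real.norm_eq_abs, Real.norm_eq_abs, sq_abs, sq_abs] at h1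
  rw [norm_add_sq_real, norm_smul, norm_smul, mul_pow, mul_pow, inner_smul_left, inner_smul_right,
    Real.norm_eq_abs, Real.norm_eq_abs, sq_abs, sq_abs]
  simp only [conj_trivial] at h1 ⊢
  have h2 : σ ^ 2 = 1 - ρ ^ 2 := by linarith
  rw [h2] at h1 ⊢
  nlinarith

/-- The noise operator improves Gaussian decay in weighted `L²`. -/
lemma exists_integral_ouOp_sq_mul_exp_le (E : Type*) [NormedAddCommGroup E]
    [InnerProductSpace ℝ E] [FiniteDimensional ℝ E] [MeasurableSpace E] [BorelSpace E]
    {ρ : ℝ} (h0 : 0 < ρ) (h1 : ρ < 1) :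
    ∃ δ B : ℝ, 0 < δ ∧ 0 ≤ B ∧ ∀ (f : E → ℝ) (C : ℝ), Measurable f → (∀ x, |f x| ≤ C) →
      Integrable (fun x ↦ ouOp ρ f x ^ 2 * Real.exp (δ * ‖x‖ ^ 2)) (stdGaussian E) ∧
      ∫ x, ouOp ρ f x ^ 2 * Real.exp (δ * ‖x‖ ^ 2) ∂(stdGaussian E) ≤
        B * ∫ x, f x ^ 2 ∂(stdGaussian E) := by
  obtain ⟨b₀, hb₀, hint⟩ := IsGaussian.exists_integrable_exp_sq (stdGaussian E)
  set A := ∫ x, Real.exp (b₀ * ‖x‖ ^ 2) ∂(stdGaussian E) with hA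
  have hA0 : 0 ≤ A := integral_nonneg fun x ↦ (Real.exp_pos _).le
  have hint' : ∀ c ≤ b₀, Integrable (fun x : E ↦ Real.exp (c * ‖x‖ ^ 2)) (stdGaussian E) := by
    intro c hc
    refine hint.mono' (Measurable.aestronglyMeasurable (by fun_prop)) (ae_of_all _ fun x ↦ ?_)
    rw [Real.norm_eq_abs, Real.abs_exp]
    gcongr
  set b := b₀ / 2 with hb
  have hb0 : 0 < b := by positivity
  set r := (1 + ρ ^ 2) / 2 with hr
  have hρ2 : ρ ^ 2 < 1 := by nlinarith
  have hr1 : r < 1 := by linarith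
  have hexp : ∀ (σ : ℝ), ρ ^ 2 + σ ^ 2 = 1 → ∀ x w : E, Real.exp (b * ‖ρ • x + σ • w‖ ^ 2)
      ≤ Real.exp (b * r * ‖x‖ ^ 2) * Real.exp (b₀ * ‖w‖ ^ 2) := by
    intro σ hσ x w
    rw [← Real.exp_add]
    refine Real.exp_le_exp.2 ?_
    have := mul_le_mul_of_nonneg_left (norm_sq_smul_add_le hσ x w) hb0.le
    rw [mul_add, ← mul_assoc b ((1 + ρ ^ 2) / 2), ← hr] at this
    have h3 : b * ((1 + ρ ^ 2) * ‖w‖ ^ 2) ≤ b₀ * ‖w‖ ^ 2 := by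
      rw [← mul_assoc]
      refine mul_le_mul_of_nonneg_right ?_ (sq_nonneg _)
      rw [hb]; nlinarith
    linarith
  refine ⟨b * (1 - r), A * A, by nlinarith, by positivity, fun f C hf hC ↦ ?_⟩
  set σ := √(1 - ρ ^ 2) with hσ
  have hσ2 : ρ ^ 2 + σ ^ 2 = 1 := by
    rw [hσ, Real.sq_sqrt (by linarith)]; ring
  -- Cauchy-Schwarz with the weight e^{±b‖y‖²/2} gives (P f)² ≤ P(f² e^{−b‖·‖²}) · P(e^{b‖·‖²}), and
  -- the second factor grows only like e^{br‖x‖²} with r < 1.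
  set g : E → ℝ := fun y ↦ f y ^ 2 * Real.exp (-b * ‖y‖ ^ 2) with hg
  have hgm : Measurable g := by fun_prop
  have hg0 : ∀ y, 0 ≤ g y := fun y ↦ by positivity
  have hgC : ∀ y, |g y| ≤ C ^ 2 := by
    intro y
    rw [abs_of_nonneg (hg0 y)]
    have h3 : f y ^ 2 ≤ C ^ 2 := sq_le_sq' (abs_le.1 (hC y)).1 (abs_le.1 (hC y)).2
    have h4 : Real.exp (-b * ‖y‖ ^ 2) ≤ 1 := Real.exp_le_one_iff.2 (by
      have := mul_nonneg hb0.le (sq_nonneg ‖y‖); linarith)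
    calc g y ≤ f y ^ 2 * 1 := mul_le_mul_of_nonneg_left h4 (sq_nonneg _)
      _ ≤ C ^ 2 := by linarith
  have hgi : ∀ x, Integrable (fun w ↦ g (ρ • x + σ • w)) (stdGaussian E) := fun x ↦
    integrable_of_bounded (by fun_prop) (fun w ↦ hgC _)
  have hPg0 : ∀ x, 0 ≤ ouOp ρ g x := fun x ↦ integral_nonneg fun w ↦ hg0 _
  have hint1 : Integrable (fun x ↦ ouOp ρ f x ^ 2 * Real.exp (b * (1 - r) * ‖x‖ ^ 2))
      (stdGaussian E) := by
    refine Integrable.bounded_mul (C := C ^ 2) (hint' _ ?_)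
      ((measurable_ouOp hf).pow_const 2) (fun x ↦ ?_)
    · rw [hb]; nlinarith
    · rw [abs_pow]
      exact pow_le_pow_left₀ (abs_nonneg _) (abs_ouOp_le hC x) 2
  have hint2 : Integrable (fun x ↦ ouOp ρ g x * Real.exp (b * ‖x‖ ^ 2)) (stdGaussian E) :=
    Integrable.bounded_mul (hint' _ (by linarith)) (measurable_ouOp hgm) (abs_ouOp_le hgC)
  refine ⟨hint1, ?_⟩
  have cs : ∀ x, ouOp ρ f x ^ 2 ≤ ouOp ρ g x * (A * Real.exp (b * r * ‖x‖ ^ 2)) := by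
    intro x
    have hi : Integrable (fun w ↦ Real.exp (b * ‖ρ • x + σ • w‖ ^ 2)) (stdGaussian E) := by
      refine (hint.const_mul (Real.exp (b * r * ‖x‖ ^ 2))).mono'
        (Measurable.aestronglyMeasurable (by fun_prop)) (ae_of_all _ fun w ↦ ?_)
      rw [Real.norm_eq_abs, Real.abs_exp]
      exact hexp σ hσ2 x w
    have hle : ∫ w, Real.exp (b * ‖ρ • x + σ • w‖ ^ 2) ∂(stdGaussian E)
        ≤ A * Real.exp (b * r * ‖x‖ ^ 2) := by
      rw [mul_comm, hA, ← integral_const_mul]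
      exact integral_mono hi (hint.const_mul _) (hexp σ hσ2 x)
    have e1 : ∀ y : E, (f y * Real.exp (-b / 2 * ‖y‖ ^ 2)) ^ 2 = g y := by
      intro y
      rw [mul_pow, ← Real.exp_nat_mul, hg]
      congr 2
      push_cast
      ring
    have e2 : ∀ y : E, (Real.exp (b / 2 * ‖y‖ ^ 2)) ^ 2 = Real.exp (b * ‖y‖ ^ 2) := by
      intro y
      rw [← Real.exp_nat_mul]
      congr 1
      push_cast
      ring
    have e3 : ∀ y : E, f y * Real.exp (-b / 2 * ‖y‖ ^ 2) * Real.exp (b / 2 * ‖y‖ ^ 2) = f y := by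
      intro y
      rw [mul_assoc, ← Real.exp_add]
      ring_nf
      simp
    have := sq_integral_mul_le (μ := stdGaussian E)
      (f := fun w ↦ f (ρ • x + σ • w) * Real.exp (-b / 2 * ‖ρ • x + σ • w‖ ^ 2))
      (g := fun w ↦ Real.exp (b / 2 * ‖ρ • x + σ • w‖ ^ 2))
      ((memLp_two_iff_integrable_sq (Measurable.aestronglyMeasurable (by fun_prop))).2 (by
        simp_rw [e1]; exact hgi x))
      ((memLp_two_iff_integrable_sq (Measurable.aestronglyMeasurable (by fun_prop))).2 (by
        simp_rw [e2]; exact hi))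
    simp_rw [e1, e2, e3] at this
    exact this.trans (mul_le_mul_of_nonneg_left hle (hPg0 x))
  have s1 : ∫ x, ouOp ρ f x ^ 2 * Real.exp (b * (1 - r) * ‖x‖ ^ 2) ∂(stdGaussian E)
      ≤ A * ∫ x, ouOp ρ g x * Real.exp (b * ‖x‖ ^ 2) ∂(stdGaussian E) := by
    rw [← integral_const_mul]
    refine integral_mono hint1 (hint2.const_mul _) fun x ↦ ?_
    simp only
    calc ouOp ρ f x ^ 2 * Real.exp (b * (1 - r) * ‖x‖ ^ 2)
        ≤ ouOp ρ g x * (A * Real.exp (b * r * ‖x‖ ^ 2)) * Real.exp (b * (1 - r) * ‖x‖ ^ 2) :=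
          mul_le_mul_of_nonneg_right (cs x) (Real.exp_pos _).le
      _ = A * (ouOp ρ g x * (Real.exp (b * r * ‖x‖ ^ 2) * Real.exp (b * (1 - r) * ‖x‖ ^ 2))) := by
          ring
      _ = _ := by
          rw [← Real.exp_add]
          congr 4
          ring
  have hf2 : Integrable (fun x ↦ f x ^ 2) (stdGaussian E) :=
    (memLp_two_of_bounded hf hC).integrable_sq
  have s2 : ∫ x, ouOp ρ g x * Real.exp (b * ‖x‖ ^ 2) ∂(stdGaussian E)
      ≤ A * ∫ x, f x ^ 2 ∂(stdGaussian E) := by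
    have hf2n : 0 ≤ ∫ x, f x ^ 2 ∂(stdGaussian E) := integral_nonneg fun x ↦ sq_nonneg _
    -- The symmetry P ↔ P* is applied to nonnegative functions in `ENNReal`, since the weight
    -- e^{b‖x‖²} is unbounded.
    rw [← ENNReal.ofReal_le_ofReal_iff (by positivity), ofReal_integral_eq_lintegral_ofReal hint2
      (ae_of_all _ fun x ↦ mul_nonneg (hPg0 x) (Real.exp_pos _).le), ENNReal.ofReal_mul hA0,
      ofReal_integral_eq_lintegral_ofReal hf2 (ae_of_all _ fun x ↦ sq_nonneg _)]
    calc ∫⁻ x, ENNReal.ofReal (ouOp ρ g x * Real.exp (b * ‖x‖ ^ 2)) ∂(stdGaussian E)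
        = ∫⁻ x, ∫⁻ w, ENNReal.ofReal (g (ρ • x + σ • w)) * ENNReal.ofReal (Real.exp (b * ‖x‖ ^ 2))
            ∂(stdGaussian E) ∂(stdGaussian E) := by
          refine lintegral_congr fun x ↦ ?_
          rw [lintegral_mul_const _ (by fun_prop), ENNReal.ofReal_mul (hPg0 x), ouOp,
            ofReal_integral_eq_lintegral_ofReal (hgi x) (ae_of_all _ fun w ↦ hg0 _)]
      _ = ∫⁻ x, ∫⁻ w, ENNReal.ofReal (g x) *
            ENNReal.ofReal (Real.exp (b * ‖ρ • x + (-σ) • w‖ ^ 2))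
            ∂(stdGaussian E) ∂(stdGaussian E) := by
          rw [← lintegral_rotation_stdGaussian hσ2 (f := fun p ↦ ENNReal.ofReal (g p.1) *
            ENNReal.ofReal (Real.exp (b * ‖ρ • p.1 + (-σ) • p.2‖ ^ 2))) (by fun_prop)]
          refine lintegral_congr fun x ↦ lintegral_congr fun w ↦ ?_
          have : ρ • (ρ • x + σ • w) + (-σ) • (-σ • x + ρ • w) = (ρ ^ 2 + σ ^ 2) • x := by module
          simp only [this, hσ2, one_smul]
      _ ≤ ∫⁻ x, ∫⁻ w, ENNReal.ofReal (f x ^ 2) * ENNReal.ofReal (Real.exp (b₀ * ‖w‖ ^ 2))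
            ∂(stdGaussian E) ∂(stdGaussian E) := by
          refine lintegral_mono fun x ↦ lintegral_mono fun w ↦ ?_
          rw [← ENNReal.ofReal_mul (hg0 x), ← ENNReal.ofReal_mul (sq_nonneg _)]
          refine ENNReal.ofReal_le_ofReal ?_
          calc g x * Real.exp (b * ‖ρ • x + (-σ) • w‖ ^ 2)
              ≤ g x * (Real.exp (b * r * ‖x‖ ^ 2) * Real.exp (b₀ * ‖w‖ ^ 2)) :=
                mul_le_mul_of_nonneg_left (hexp (-σ) (by rw [neg_sq]; exact hσ2) x w) (hg0 x)
            _ = f x ^ 2 * Real.exp (b₀ * ‖w‖ ^ 2) * Real.exp (-(b * (1 - r)) * ‖x‖ ^ 2) := by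
                rw [hg]
                have : Real.exp (-(b * (1 - r)) * ‖x‖ ^ 2)
                    = Real.exp (-b * ‖x‖ ^ 2) * Real.exp (b * r * ‖x‖ ^ 2) := by
                  rw [← Real.exp_add]
                  ring_nf
                rw [this]
                ring
            _ ≤ f x ^ 2 * Real.exp (b₀ * ‖w‖ ^ 2) := by
                refine mul_le_of_le_one_right (by positivity) (Real.exp_le_one_iff.2 ?_)
                have : 0 ≤ b * (1 - r) * ‖x‖ ^ 2 :=
                  mul_nonneg (mul_nonneg hb0.le (by linarith)) (sq_nonneg _)
                linarith
      _ = _ := by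
          simp_rw [lintegral_const_mul _ (show Measurable fun w : E ↦
            ENNReal.ofReal (Real.exp (b₀ * ‖w‖ ^ 2)) by fun_prop)]
          rw [lintegral_mul_const _ (by fun_prop), hA, ofReal_integral_eq_lintegral_ofReal hint
            (ae_of_all _ fun x ↦ (Real.exp_pos _).le), mul_comm]
  refine s1.trans ?_
  rw [mul_assoc]
  exact mul_le_mul_of_nonneg_left s2 hA0

end WeightedBound

/-! ### Comparison of relative entropy with squared differences. -/

section KLBounds

open InformationTheory

/-- The derivative is (y − 1)²/y. The function vanishes at 1, so its sign is known on each side of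
1. -/
lemma monotoneOn_log_sub_quadratic :
    MonotoneOn (fun y : ℝ ↦ Real.log y - (y - 1) + (y - 1) ^ 2 / 2) (Set.Ioi 0) := by
  have hd : ∀ y ∈ Set.Ioi (0 : ℝ), HasDerivAt (fun y : ℝ ↦ Real.log y - (y - 1) + (y - 1) ^ 2 / 2)
      (y⁻¹ - 1 + (2 * (y - 1)) / 2) y := by
    intro y hy
    have h1 : HasDerivAt (fun y : ℝ ↦ y - 1) 1 y := (hasDerivAt_id y).sub_const 1
    have := (((Real.hasDerivAt_log (ne_of_gt hy)).sub h1).add ((h1.pow 2).div_const 2))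
    convert! this using 1
    simp
  refine monotoneOn_of_deriv_nonneg (convex_Ioi 0)
    (fun y hy ↦ (hd y hy).continuousAt.continuousWithinAt)
    (fun y hy ↦ (hd y (interior_subset hy)).differentiableAt.differentiableWithinAt)
    (fun y hy ↦ ?_)
  have hy' : 0 < y := interior_subset hy
  rw [(hd y hy').deriv]
  have : y⁻¹ - 1 + 2 * (y - 1) / 2 = (y - 1) ^ 2 / y := by field_simp; ring
  rw [this]
  positivity

/-- The derivative is (y − 1)²/(2y²), again with a zero at 1. -/
lemma monotoneOn_half_sub_inv_sub_log :
    MonotoneOn (fun y : ℝ ↦ (y - y⁻¹) / 2 - Real.log y) (Set.Ioi 0) := by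
  have hd : ∀ y ∈ Set.Ioi (0 : ℝ), HasDerivAt (fun y : ℝ ↦ (y - y⁻¹) / 2 - Real.log y)
      ((1 - -(y ^ 2)⁻¹) / 2 - y⁻¹) y := fun y hy ↦
    (((hasDerivAt_id y).sub (hasDerivAt_inv (ne_of_gt hy))).div_const 2).sub
      (Real.hasDerivAt_log (ne_of_gt hy))
  refine monotoneOn_of_deriv_nonneg (convex_Ioi 0)
    (fun y hy ↦ (hd y hy).continuousAt.continuousWithinAt)
    (fun y hy ↦ (hd y (interior_subset hy)).differentiableAt.differentiableWithinAt)
    (fun y hy ↦ ?_)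
  have hy' : 0 < y := interior_subset hy
  rw [(hd y hy').deriv]
  have : (1 - -(y ^ 2)⁻¹) / 2 - y⁻¹ = (y - 1) ^ 2 / (2 * y ^ 2) := by field_simp; ring
  rw [this]
  positivity

/-- The difference of `klFun` from (x−1)²/(2x) and from (x−1)²/2 is expressed through the two
monotone functions above, the first taken at 1/x. Their signs swap at x = 1, which produces max and
min. -/
lemma klFun_bounds {x : ℝ} (hx : 0 < x) :
    (x - 1) ^ 2 / (2 * max x 1) ≤ klFun x ∧ klFun x ≤ (x - 1) ^ 2 / (2 * min x 1) := by
  have hx' : 0 < x⁻¹ := inv_pos.2 hx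
  have e1 : klFun x = x * (-(Real.log x⁻¹ - (x⁻¹ - 1) + (x⁻¹ - 1) ^ 2 / 2))
      + (x - 1) ^ 2 / (2 * x) := by
    rw [klFun_apply, Real.log_inv]; field_simp; ring
  have e2 : klFun x = (x - 1) ^ 2 / 2 - x * ((x - x⁻¹) / 2 - Real.log x) := by
    rw [klFun_apply]; field_simp; ring
  rcases le_total 1 x with h | h
  · have hi : x⁻¹ ≤ 1 := inv_le_one_of_one_le₀ h
    have h1 := monotoneOn_log_sub_quadratic hx' (Set.mem_Ioi.2 one_pos) hi
    have h2 := monotoneOn_half_sub_inv_sub_log (Set.mem_Ioi.2 one_pos) hx h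
    simp at h1 h2
    rw [max_eq_left h, min_eq_right h]
    constructor
    · rw [e1]
      have := mul_nonneg hx.le (neg_nonneg.2 (by rw [Real.log_inv]; linarith :
        Real.log x⁻¹ - (x⁻¹ - 1) + (x⁻¹ - 1) ^ 2 / 2 ≤ 0))
      linarith
    · rw [e2]
      have := mul_nonneg hx.le (by linarith : 0 ≤ (x - x⁻¹) / 2 - Real.log x)
      linarith
  · have hi : 1 ≤ x⁻¹ := (one_le_inv₀ hx).2 h
    have h1 := monotoneOn_log_sub_quadratic (Set.mem_Ioi.2 one_pos) hx' hi
    have h2 := monotoneOn_half_sub_inv_sub_log hx (Set.mem_Ioi.2 one_pos) h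
    simp at h1 h2
    rw [max_eq_right h, min_eq_left h]
    constructor
    · rw [e2]
      have := mul_nonneg hx.le (neg_nonneg.2 (by linarith : (x - x⁻¹) / 2 - Real.log x ≤ 0))
      linarith
    · rw [e1]
      have := mul_nonneg hx.le (by rw [Real.log_inv]; linarith :
        0 ≤ Real.log x⁻¹ - (x⁻¹ - 1) + (x⁻¹ - 1) ^ 2 / 2)
      linarith

/-- Homogeneous form: multiplying by q turns max(p/q, 1) into max(p, q). Only an upper bound on the
densities is needed here; the reverse estimate below needs a lower one. -/
lemma le_mul_klFun_div {p q M : ℝ} (hp : 0 < p) (hq : 0 < q) (hpM : p ≤ M) (hqM : q ≤ M) :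
    (p - q) ^ 2 / (2 * M) ≤ q * klFun (p / q) := by
  have h := mul_le_mul_of_nonneg_left (klFun_bounds (div_pos hp hq)).1 hq.le
  refine le_trans ?_ h
  have hm : q * max (p / q) 1 = max p q := by
    rw [mul_max_of_nonneg _ _ hq.le, mul_div_cancel₀ _ hq.ne', mul_one]
  have hmax : 0 < max (p / q) 1 := lt_max_of_lt_right one_pos
  have : q * ((p / q - 1) ^ 2 / (2 * max (p / q) 1)) = (p - q) ^ 2 / (2 * max p q) := by
    rw [← hm]; field_simp
  rw [this]
  have : max p q ≤ M := max_le hpM hqM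
  have : 0 < max p q := lt_max_of_lt_left hp
  gcongr

lemma mul_klFun_div_le {p q m : ℝ} (hm : 0 < m) (hpm : m ≤ p) (hqm : m ≤ q) :
    q * klFun (p / q) ≤ (p - q) ^ 2 / (2 * m) := by
  have hp : 0 < p := hm.trans_le hpm
  have hq : 0 < q := hm.trans_le hqm
  have h := mul_le_mul_of_nonneg_left (klFun_bounds (div_pos hp hq)).2 hq.le
  refine h.trans ?_
  have hmin : q * min (p / q) 1 = min p q := by
    rw [mul_min_of_nonneg _ _ hq.le, mul_div_cancel₀ _ hq.ne', mul_one]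
  have hmin0 : 0 < min (p / q) 1 := lt_min (div_pos hp hq) one_pos
  have : q * ((p / q - 1) ^ 2 / (2 * min (p / q) 1)) = (p - q) ^ 2 / (2 * min p q) := by
    rw [← hmin]; field_simp
  rw [this]
  have : m ≤ min p q := le_min hpm hqm
  gcongr

lemma klDiv_withDensity {Ω : Type*} [MeasurableSpace Ω] {μ : Measure Ω} [SigmaFinite μ]
    {F G : Ω → ℝ} (hF : Measurable F) (hG : Measurable G) (hG0 : ∀ x, 0 < G x)
    (hF0 : ∀ x, 0 < F x)
    [IsFiniteMeasure (μ.withDensity fun x ↦ ENNReal.ofReal (F x))]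
    [IsFiniteMeasure (μ.withDensity fun x ↦ ENNReal.ofReal (G x))] :
    klDiv (μ.withDensity fun x ↦ ENNReal.ofReal (F x))
      (μ.withDensity fun x ↦ ENNReal.ofReal (G x))
      = ∫⁻ x, ENNReal.ofReal (G x * klFun (F x / G x)) ∂μ := by
  set ν := μ.withDensity fun x ↦ ENNReal.ofReal (G x) with hν
  have e : (μ.withDensity fun x ↦ ENNReal.ofReal (F x))
      = ν.withDensity (fun x ↦ ENNReal.ofReal (F x / G x)) := by
    rw [hν, ← withDensity_mul _ (by fun_prop) (by fun_prop)]
    congr 1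
    ext x
    rw [Pi.mul_apply, ← ENNReal.ofReal_mul (hG0 x).le, mul_div_cancel₀ _ (hG0 x).ne']
  have hfin : IsFiniteMeasure (ν.withDensity (fun x ↦ ENNReal.ofReal (F x / G x))) := by
    rw [← e]; infer_instance
  rw [e, klDiv_eq_lintegral_klFun_of_ac (withDensity_absolutelyContinuous _ _)]
  have hr := Measure.rnDeriv_withDensity ν
    (show Measurable fun x ↦ ENNReal.ofReal (F x / G x) by fun_prop)
  have : ∫⁻ x, ENNReal.ofReal (klFun ((ν.withDensity fun x ↦
      ENNReal.ofReal (F x / G x)).rnDeriv ν x).toReal) ∂ν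
      = ∫⁻ x, ENNReal.ofReal (klFun (F x / G x)) ∂ν := by
    refine lintegral_congr_ae ?_
    filter_upwards [hr] with x hx
    rw [hx, ENNReal.toReal_ofReal (div_pos (hF0 x) (hG0 x)).le]
  have hm := measurable_klFun
  rw [this, hν, lintegral_withDensity_eq_lintegral_mul _ (by fun_prop) (by fun_prop)]
  refine lintegral_congr fun x ↦ ?_
  rw [Pi.mul_apply, ENNReal.ofReal_mul (hG0 x).le]

end KLBounds

/-! ### Entropy contraction under Ornstein-Uhlenbeck noise. -/

section NoiseMeasure

open InformationTheory

variable {E : Type*} [NormedAddCommGroup E] [InnerProductSpace ℝ E] [FiniteDimensional ℝ E]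
  [MeasurableSpace E] [BorelSpace E]

/-- The law of `ρ X + √(1-ρ²) W` for `X` of law `μ` and `W` an independent standard Gaussian. -/
noncomputable def ouMeasure (ρ : ℝ) (μ : Measure E) : Measure E :=
  (μ.map (fun x ↦ ρ • x)).conv ((stdGaussian E).map (fun x ↦ √(1 - ρ ^ 2) • x))

instance isProbabilityMeasure_map_smul (c : ℝ) (μ : Measure E) [IsProbabilityMeasure μ] :
    IsProbabilityMeasure (μ.map (fun x ↦ c • x)) :=
  Measure.isProbabilityMeasure_map (by fun_prop)

lemma map_neg_stdGaussian : (stdGaussian E).map (fun x ↦ -x) = stdGaussian E :=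
  stdGaussian_map (LinearIsometryEquiv.neg ℝ)

/-- This is reversibility: the noise acting on measures is adjoint to `ouOp`, which is symmetric for
the standard Gaussian. -/
lemma ouMeasure_withDensity {ρ C : ℝ} (h0 : 0 ≤ ρ) (h1 : ρ ≤ 1) {F : E → ℝ} (hF : Measurable F)
    (hF0 : ∀ x, 0 ≤ F x) (hC : ∀ x, |F x| ≤ C) :
    ouMeasure ρ ((stdGaussian E).withDensity fun x ↦ ENNReal.ofReal (F x))
      = (stdGaussian E).withDensity fun x ↦ ENNReal.ofReal (ouOp ρ F x) := by
  set σ := √(1 - ρ ^ 2) with hσ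
  have hσ2 : ρ ^ 2 + (-σ) ^ 2 = 1 := by
    rw [neg_sq, hσ, Real.sq_sqrt (one_sub_sq_nonneg h0 h1)]; ring
  refine Measure.ext_of_lintegral _ fun f hf ↦ ?_
  have hm := measurable_ouOp (t := ρ) hF
  rw [ouMeasure, Measure.lintegral_conv hf, lintegral_map (by fun_prop) (by fun_prop),
    lintegral_withDensity_eq_lintegral_mul _ (by fun_prop) (by fun_prop),
    lintegral_withDensity_eq_lintegral_mul _ (by fun_prop) (by fun_prop)]
  simp only [Pi.mul_apply]
  calc ∫⁻ x, ENNReal.ofReal (F x) * ∫⁻ y, f (ρ • x + y) ∂((stdGaussian E).map (fun x ↦ σ • x))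
        ∂(stdGaussian E)
      = ∫⁻ x, ∫⁻ w, ENNReal.ofReal (F x) * f (ρ • x + (-σ) • w) ∂(stdGaussian E)
        ∂(stdGaussian E) := by
        refine lintegral_congr fun x ↦ ?_
        rw [lintegral_map (by fun_prop) (by fun_prop), lintegral_const_mul _ (by fun_prop)]
        congr 1
        -- The sign of the noise is flipped to match the orientation of the rotation.
        conv_lhs => rw [← map_neg_stdGaussian]
        rw [lintegral_map (by fun_prop) (by fun_prop)]
        simp
    _ = ∫⁻ x, ∫⁻ w, ENNReal.ofReal (F (ρ • x + σ • w)) * f x ∂(stdGaussian E)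
        ∂(stdGaussian E) := by
        rw [← lintegral_rotation_stdGaussian hσ2
          (f := fun p ↦ ENNReal.ofReal (F (ρ • p.1 + σ • p.2)) * f p.1) (by fun_prop)]
        refine lintegral_congr fun x ↦ lintegral_congr fun w ↦ ?_
        have : ρ • (ρ • x + (-σ) • w) + σ • (-(-σ) • x + ρ • w) = (ρ ^ 2 + (-σ) ^ 2) • x := by
          module
        simp only [this, hσ2, one_smul]
    _ = ∫⁻ x, ENNReal.ofReal (ouOp ρ F x) * f x ∂(stdGaussian E) := by
        refine lintegral_congr fun x ↦ ?_
        rw [lintegral_mul_const _ (by fun_prop), ouOp, ofReal_integral_eq_lintegral_ofReal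
          (integrable_of_bounded (by fun_prop) (fun w ↦ hC _)) (ae_of_all _ fun w ↦ hF0 _)]

lemma ouOp_sub {ρ C : ℝ} {F G : E → ℝ} (hF : Measurable F) (hG : Measurable G)
    (hFC : ∀ x, |F x| ≤ C) (hGC : ∀ x, |G x| ≤ C) (x : E) :
    ouOp ρ (fun x ↦ F x - G x) x = ouOp ρ F x - ouOp ρ G x :=
  integral_sub (integrable_of_bounded (by fun_prop) (fun w ↦ hFC _))
    (integrable_of_bounded (by fun_prop) (fun w ↦ hGC _))

/-- From ‖ρx + σw‖² ≤ 2‖x‖² + 2‖w‖² and e^{−z} ≥ 1 − z, followed by integration over w. Noise at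
worst doubles the decay rate of a Gaussian lower bound. -/
lemma le_ouOp {ρ η m C : ℝ} (h0 : 0 ≤ ρ) (h1 : ρ ≤ 1) (hη : 0 ≤ η) (hm : 0 ≤ m) {F : E → ℝ}
    (hF : Measurable F)
    (hC : ∀ x, |F x| ≤ C) (hl : ∀ x, m * Real.exp (-η * ‖x‖ ^ 2) ≤ F x) (x : E) :
    m * (1 - 2 * η * ∫ w, ‖w‖ ^ 2 ∂(stdGaussian E)) * Real.exp (-(2 * η) * ‖x‖ ^ 2)
      ≤ ouOp ρ F x := by
  have hsq : Integrable (fun y : E ↦ ‖y‖ ^ 2) (stdGaussian E) :=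
    (IsGaussian.memLp_two_id (μ := stdGaussian E)).integrable_norm_pow (by norm_num)
  have e : m * (1 - 2 * η * ∫ w, ‖w‖ ^ 2 ∂(stdGaussian E)) * Real.exp (-(2 * η) * ‖x‖ ^ 2)
      = ∫ w, m * Real.exp (-(2 * η) * ‖x‖ ^ 2) * (1 - 2 * η * ‖w‖ ^ 2) ∂(stdGaussian E) := by
    rw [integral_const_mul, integral_sub (integrable_const _) (hsq.const_mul _),
      integral_const_mul]
    simp
    ring
  rw [e]
  refine integral_mono (((integrable_const _).sub (hsq.const_mul _)).const_mul _)
    (integrable_of_bounded (by fun_prop) (fun w ↦ hC _)) fun w ↦ ?_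
  refine le_trans ?_ (hl _)
  rw [mul_assoc]
  refine mul_le_mul_of_nonneg_left ?_ hm
  have h3 := norm_sq_smul_add_le (ρ := ρ) (σ := √(1 - ρ ^ 2))
    (by rw [Real.sq_sqrt (one_sub_sq_nonneg h0 h1)]; ring) x w
  have hρ : ρ ^ 2 ≤ 1 := by nlinarith
  have h4 : ‖ρ • x + √(1 - ρ ^ 2) • w‖ ^ 2 ≤ 2 * ‖x‖ ^ 2 + 2 * ‖w‖ ^ 2 := by
    refine h3.trans ?_
    nlinarith [sq_nonneg ‖x‖, sq_nonneg ‖w‖]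
  calc Real.exp (-(2 * η) * ‖x‖ ^ 2) * (1 - 2 * η * ‖w‖ ^ 2)
      ≤ Real.exp (-(2 * η) * ‖x‖ ^ 2) * Real.exp (-(2 * η * ‖w‖ ^ 2)) := by
        refine mul_le_mul_of_nonneg_left ?_ (Real.exp_pos _).le
        have := Real.add_one_le_exp (-(2 * η * ‖w‖ ^ 2))
        linarith
    _ ≤ Real.exp (-η * ‖ρ • x + √(1 - ρ ^ 2) • w‖ ^ 2) := by
        rw [← Real.exp_add]
        refine Real.exp_le_exp.2 ?_
        have := mul_le_mul_of_nonneg_left h4 hη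
        linarith

lemma isFiniteMeasure_withDensity_of_bounded {Ω : Type*} [MeasurableSpace Ω] {μ : Measure Ω}
    [IsFiniteMeasure μ] {F : Ω → ℝ} {C : ℝ} (hC : ∀ x, F x ≤ C) :
    IsFiniteMeasure (μ.withDensity fun x ↦ ENNReal.ofReal (F x)) := by
  refine isFiniteMeasure_withDensity (ne_of_lt ?_)
  calc ∫⁻ x, ENNReal.ofReal (F x) ∂μ ≤ ∫⁻ _, ENNReal.ofReal C ∂μ :=
        lintegral_mono fun x ↦ ENNReal.ofReal_le_ofReal (hC x)
    _ < ∞ := by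
        rw [lintegral_const]
        exact ENNReal.mul_lt_top ENNReal.ofReal_lt_top (measure_lt_top _ _)

/-- Continuity at η = 0, where the last expression is κr < 1. Here r will be ρ⁶, and the other
factors are the losses in comparing entropy with L² distance. -/
lemma exists_small_parameter {κ r m B δ : ℝ} (h : κ * r < 1) (hδ : 0 < δ) :
    ∃ η : ℝ, 0 < η ∧ 2 * η ≤ δ ∧ 2 * η * m < 1 ∧
      κ * ((1 + η) ^ 2 / (1 - 2 * η * m) * (r + 2 * η / δ * B)) ≤ 1 := by
  have c1 : ContinuousAt (fun η : ℝ ↦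
      κ * ((1 + η) ^ 2 / (1 - 2 * η * m) * (r + 2 * η / δ * B))) 0 := by
    have : (1 - 2 * (0 : ℝ) * m) ≠ 0 := by simp
    fun_prop (disch := assumption)
  have e1 : ∀ᶠ η in nhds (0 : ℝ),
      κ * ((1 + η) ^ 2 / (1 - 2 * η * m) * (r + 2 * η / δ * B)) < 1 :=
    c1.eventually_lt_const (by simpa using h)
  have e2 : ∀ᶠ η in nhds (0 : ℝ), 2 * η * m < 1 :=
    
    (show ContinuousAt (fun η : ℝ ↦ 2 * η * m) 0 by fun_prop).eventually_lt_const (by simp)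
  have e3 : ∀ᶠ η in nhds (0 : ℝ), 2 * η < δ :=
    
    (show ContinuousAt (fun η : ℝ ↦ 2 * η) 0 by fun_prop).eventually_lt_const (by simpa using hδ)
  obtain ⟨η, ⟨h1, h2, h3⟩, h4⟩ := ((((e1.and (e2.and e3)).filter_mono nhdsWithin_le_nhds :
    ∀ᶠ η in nhdsWithin (0 : ℝ) (Set.Ioi 0), _)).and self_mem_nhdsWithin).exists
  exact ⟨η, h4, h3.le, h2, h1.le⟩

/-- Entropic contraction under noise, for pairs of measures close to the standard Gaussian which
share their moments of order at most two. -/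
lemma exists_klDiv_ouMeasure_le (E : Type*) [NormedAddCommGroup E] [InnerProductSpace ℝ E]
    [FiniteDimensional ℝ E] [MeasurableSpace E] [BorelSpace E] {ρ κ : ℝ} (h0 : 0 < ρ) (h1 : ρ < 1)
    (hκ : 0 ≤ κ) (hκρ : κ * ρ ^ 6 < 1) :
    ∃ η : ℝ, 0 < η ∧ ∀ F G : E → ℝ, Measurable F → Measurable G →
      (∀ x, (1 + η)⁻¹ * Real.exp (-η * ‖x‖ ^ 2) ≤ F x) → (∀ x, F x ≤ 1 + η) →
      (∀ x, (1 + η)⁻¹ * Real.exp (-η * ‖x‖ ^ 2) ≤ G x) → (∀ x, G x ≤ 1 + η) →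
      OrthQuadratic (fun x ↦ F x - G x) →
      ENNReal.ofReal κ *
        klDiv (ouMeasure ρ ((stdGaussian E).withDensity fun x ↦ ENNReal.ofReal (F x)))
          (ouMeasure ρ ((stdGaussian E).withDensity fun x ↦ ENNReal.ofReal (G x)))
        ≤ klDiv ((stdGaussian E).withDensity fun x ↦ ENNReal.ofReal (F x))
          ((stdGaussian E).withDensity fun x ↦ ENNReal.ofReal (G x)) := by
  obtain ⟨δ, B, hδ, hB, hw⟩ := exists_integral_ouOp_sq_mul_exp_le E h0 h1
  set m := ∫ w, ‖w‖ ^ 2 ∂(stdGaussian E) with hm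
  obtain ⟨η, hη, hηδ, hηm, hηκ⟩ := exists_small_parameter (m := m) (B := B) hκρ hδ
  refine ⟨η, hη, fun F G hF hG hFl hFu hGl hGu horth ↦ ?_⟩
  have hpos : ∀ x : E, 0 < (1 + η)⁻¹ * Real.exp (-η * ‖x‖ ^ 2) := fun x ↦ by positivity
  have hF0 : ∀ x, 0 < F x := fun x ↦ (hpos x).trans_le (hFl x)
  have hG0 : ∀ x, 0 < G x := fun x ↦ (hpos x).trans_le (hGl x)
  have hFC : ∀ x, |F x| ≤ 1 + η := fun x ↦ by rw [abs_of_pos (hF0 x)]; exact hFu x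
  have hGC : ∀ x, |G x| ≤ 1 + η := fun x ↦ by rw [abs_of_pos (hG0 x)]; exact hGu x
  have hψC : ∀ x, |F x - G x| ≤ 1 + η := fun x ↦ by
    rw [abs_le]; constructor <;> linarith [hF0 x, hG0 x, hFu x, hGu x]
  have hψ : Measurable fun x ↦ F x - G x := hF.sub hG
  have hc : 0 < 1 - 2 * η * m := by linarith
  have hml : ∀ x : E, 0 < (1 + η)⁻¹ * (1 - 2 * η * m) * Real.exp (-(2 * η) * ‖x‖ ^ 2) :=
    fun x ↦ by positivity
  have hPF := le_ouOp h0.le h1.le hη.le (by positivity) hF hFC hFl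
  have hPG := le_ouOp h0.le h1.le hη.le (by positivity) hG hGC hGl
  rw [← hm] at hPF hPG
  have := isFiniteMeasure_withDensity_of_bounded (μ := stdGaussian E) hFu
  have := isFiniteMeasure_withDensity_of_bounded (μ := stdGaussian E) hGu
  have := isFiniteMeasure_withDensity_of_bounded (μ := stdGaussian E)
    (fun x ↦ (le_abs_self _).trans (abs_ouOp_le (t := ρ) hFC x))
  have := isFiniteMeasure_withDensity_of_bounded (μ := stdGaussian E)
    (fun x ↦ (le_abs_self _).trans (abs_ouOp_le (t := ρ) hGC x))
  rw [ouMeasure_withDensity h0.le h1.le hF (fun x ↦ (hF0 x).le) hFC,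
    ouMeasure_withDensity h0.le h1.le hG (fun x ↦ (hG0 x).le) hGC,
    klDiv_withDensity hF hG hG0 hF0, klDiv_withDensity (measurable_ouOp hF) (measurable_ouOp hG)
      (fun x ↦ (hml x).trans_le (hPG x)) (fun x ↦ (hml x).trans_le (hPF x))]
  set S := ∫ x, (F x - G x) ^ 2 ∂(stdGaussian E) with hS
  have hS0 : 0 ≤ S := integral_nonneg fun x ↦ sq_nonneg _
  have hψ2 : Integrable (fun x ↦ (F x - G x) ^ 2) (stdGaussian E) :=
    (memLp_two_of_bounded hψ hψC).integrable_sq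
  have hin : ENNReal.ofReal ((2 * (1 + η))⁻¹ * S)
      ≤ ∫⁻ x, ENNReal.ofReal (G x * klFun (F x / G x)) ∂(stdGaussian E) := by
    rw [hS, ← integral_const_mul, ofReal_integral_eq_lintegral_ofReal (hψ2.const_mul _)
      (ae_of_all _ fun x ↦ by positivity)]
    refine lintegral_mono fun x ↦ ENNReal.ofReal_le_ofReal ?_
    have := le_mul_klFun_div (hF0 x) (hG0 x) (hFu x) (hGu x)
    rwa [div_eq_inv_mul] at this
  obtain ⟨hwi, hwle⟩ := hw _ _ hψ hψC
  have hPψ2 : Integrable (fun x ↦ ouOp ρ (fun x ↦ F x - G x) x ^ 2) (stdGaussian E) :=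
    (memLp_two_of_bounded (measurable_ouOp hψ) (abs_ouOp_le hψC)).integrable_sq
  set c := (1 + η) / (2 * (1 - 2 * η * m)) with hcdef
  have hc0 : 0 ≤ c := by positivity
  -- Dividing by the lower bound of the densities costs a weight e^{2η‖x‖²}.
  have hout : ∫⁻ x, ENNReal.ofReal (ouOp ρ G x * klFun (ouOp ρ F x / ouOp ρ G x)) ∂(stdGaussian E)
      ≤ ENNReal.ofReal (c * ((ρ ^ 6 + 2 * η / δ * B) * S)) := by
    calc ∫⁻ x, ENNReal.ofReal (ouOp ρ G x * klFun (ouOp ρ F x / ouOp ρ G x)) ∂(stdGaussian E)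
        ≤ ∫⁻ x, ENNReal.ofReal (c * (ouOp ρ (fun x ↦ F x - G x) x ^ 2 + 2 * η / δ *
            (ouOp ρ (fun x ↦ F x - G x) x ^ 2 * Real.exp (δ * ‖x‖ ^ 2)))) ∂(stdGaussian E) := by
          refine lintegral_mono fun x ↦ ENNReal.ofReal_le_ofReal ?_
          refine (mul_klFun_div_le (hml x) (hPF x) (hPG x)).trans ?_
          rw [← ouOp_sub hF hG hFC hGC]
          set P := ouOp ρ (fun x ↦ F x - G x) x with hP
          have e : P ^ 2 / (2 * ((1 + η)⁻¹ * (1 - 2 * η * m) * Real.exp (-(2 * η) * ‖x‖ ^ 2)))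
              = c * (P ^ 2 * Real.exp (2 * η / δ * (δ * ‖x‖ ^ 2))) := by
            have : Real.exp (-(2 * η) * ‖x‖ ^ 2)
                = (Real.exp (2 * η / δ * (δ * ‖x‖ ^ 2)))⁻¹ := by
              rw [← Real.exp_neg]
              congr 1
              field_simp
            rw [this, hcdef]
            field_simp
          rw [e]
          refine mul_le_mul_of_nonneg_left ?_ hc0
          have hθ0 : 0 ≤ 2 * η / δ := by positivity
          have hθ1 : 2 * η / δ ≤ 1 := (div_le_one hδ).2 hηδ
          -- Convexity bounds the weight by 1 + θe^{δ‖x‖²} with θ = 2η/δ. The constant part meets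
          -- the sharp factor ρ⁶, while the crude constant B appears only with the small coefficient
          -- θ.
          have hconv := convexOn_exp.2 (Set.mem_univ (δ * ‖x‖ ^ 2)) (Set.mem_univ 0) hθ0
            (sub_nonneg.2 hθ1) (by ring)
          simp only [smul_eq_mul, mul_zero, add_zero, Real.exp_zero, mul_one] at hconv
          have h3 : Real.exp (2 * η / δ * (δ * ‖x‖ ^ 2))
              ≤ 1 + 2 * η / δ * Real.exp (δ * ‖x‖ ^ 2) := by linarith
          calc P ^ 2 * Real.exp (2 * η / δ * (δ * ‖x‖ ^ 2))
              ≤ P ^ 2 * (1 + 2 * η / δ * Real.exp (δ * ‖x‖ ^ 2)) :=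
                mul_le_mul_of_nonneg_left h3 (sq_nonneg _)
            _ = _ := by ring
      _ = ENNReal.ofReal (c * (∫ x, ouOp ρ (fun x ↦ F x - G x) x ^ 2 ∂(stdGaussian E) + 2 * η / δ *
            ∫ x, ouOp ρ (fun x ↦ F x - G x) x ^ 2 * Real.exp (δ * ‖x‖ ^ 2) ∂(stdGaussian E))) := by
          rw [← integral_const_mul (2 * η / δ), ← integral_add hPψ2 (hwi.const_mul _),
            ← integral_const_mul, ofReal_integral_eq_lintegral_ofReal
              ((hPψ2.fun_add (hwi.const_mul _)).const_mul _) (ae_of_all _ fun x ↦ by positivity)]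
      _ ≤ _ := by
          refine ENNReal.ofReal_le_ofReal (mul_le_mul_of_nonneg_left ?_ hc0)
          have h3 := horth.integral_ouOp_sq_le hψ hψC h0 h1
          have h4 := mul_le_mul_of_nonneg_left hwle (by positivity : 0 ≤ 2 * η / δ)
          rw [← hS] at h3 h4
          linarith
  refine le_trans ?_ hin
  refine (mul_le_mul_right hout _).trans ?_
  rw [← ENNReal.ofReal_mul hκ]
  refine ENNReal.ofReal_le_ofReal ?_
  have e : κ * (c * ((ρ ^ 6 + 2 * η / δ * B) * S)) = κ * ((1 + η) ^ 2 / (1 - 2 * η * m) *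
      (ρ ^ 6 + 2 * η / δ * B)) * ((2 * (1 + η))⁻¹ * S) := by
    rw [hcdef]; field_simp
  rw [e]
  exact mul_le_of_le_one_left (by positivity) hηκ

end NoiseMeasure

/-! ### Multivariate Gaussians and positive definite matrices. -/

section GaussianMatrix

open Matrix WithLp
open scoped MatrixOrder

variable {d : ℕ}

lemma inner_toEuclideanCLM_left (M : Matrix (Fin d) (Fin d) ℝ) (x y : EuclideanSpace ℝ (Fin d)) :
    inner ℝ (toEuclideanCLM (𝕜 := ℝ) M x) y = inner ℝ x (toEuclideanCLM (𝕜 := ℝ) Mᵀ y) := by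
  rw [real_inner_comm, inner_toEuclideanCLM, inner_toEuclideanCLM, Matrix.mulVec_transpose,
    dotProduct_mulVec, dotProduct_comm]

lemma norm_sq_eq_dotProduct (x : EuclideanSpace ℝ (Fin d)) : ‖x‖ ^ 2 = ofLp x ⬝ᵥ ofLp x := by
  rw [EuclideanSpace.real_norm_sq_eq]
  simp [dotProduct, pow_two]

lemma map_multivariateGaussian_zero {S : Matrix (Fin d) (Fin d) ℝ} (hS : S.PosSemidef)
    (M : Matrix (Fin d) (Fin d) ℝ) :
    (multivariateGaussian 0 S).map (toEuclideanCLM (𝕜 := ℝ) M)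
      = multivariateGaussian 0 (M * S * Mᵀ) := by
  have hS' : (M * S * Mᵀ).PosSemidef := by
    have := hS.mul_mul_conjTranspose_same M
    rwa [conjTranspose_eq_transpose_of_trivial] at this
  have : IsProbabilityMeasure ((multivariateGaussian 0 S).map (toEuclideanCLM (𝕜 := ℝ) M)) :=
    Measure.isProbabilityMeasure_map (by fun_prop)
  refine Measure.ext_of_charFun ?_
  ext t
  rw [charFun_multivariateGaussian hS', charFun_apply, integral_map (by fun_prop) (by fun_prop)]
  simp_rw [inner_toEuclideanCLM_left]
  rw [← charFun_apply, charFun_multivariateGaussian hS]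
  simp only [inner_zero_right, ofLp_toEuclideanCLM]
  congr 4
  rw [← mulVec_mulVec, ← mulVec_mulVec, dotProduct_mulVec _ M, ← mulVec_transpose]

lemma multivariateGaussian_conv {S S' : Matrix (Fin d) (Fin d) ℝ} (hS : S.PosSemidef)
    (hS' : S'.PosSemidef) :
    (multivariateGaussian 0 S).conv (multivariateGaussian 0 S')
      = multivariateGaussian 0 (S + S') := by
  refine Measure.ext_of_charFun ?_
  ext t
  rw [charFun_conv, charFun_multivariateGaussian hS, charFun_multivariateGaussian hS',
    charFun_multivariateGaussian (hS.add hS'), ← Complex.exp_add]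
  congr 1
  simp only [inner_zero_right, add_mulVec, dotProduct_add]
  push_cast
  ring

/-- The density of the Gaussian measure with mean `m` and covariance `S`. -/
noncomputable def gaussianDensity (m : EuclideanSpace ℝ (Fin d)) (S : Matrix (Fin d) (Fin d) ℝ)
    (x : EuclideanSpace ℝ (Fin d)) : ℝ :=
  (√S.det)⁻¹ * ((2 * Real.pi) ^ (-(d / 2 : ℝ)) *
    Real.exp (-(ofLp (x - m) ⬝ᵥ S⁻¹ *ᵥ ofLp (x - m)) / 2))

lemma gaussianDensity_pos (m : EuclideanSpace ℝ (Fin d)) {S : Matrix (Fin d) (Fin d) ℝ}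
    (hS : S.PosDef) (x : EuclideanSpace ℝ (Fin d)) : 0 < gaussianDensity m S x := by
  have := hS.det_pos
  unfold gaussianDensity
  positivity

lemma measurable_gaussianDensity (m : EuclideanSpace ℝ (Fin d)) (S : Matrix (Fin d) (Fin d) ℝ) :
    Measurable (gaussianDensity m S) := by
  have : (fun x : EuclideanSpace ℝ (Fin d) ↦ ofLp (x - m) ⬝ᵥ S⁻¹ *ᵥ ofLp (x - m))
      = fun x ↦ inner ℝ (x - m) (toEuclideanCLM (𝕜 := ℝ) S⁻¹ (x - m)) := by
    ext x; rw [inner_toEuclideanCLM]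
  unfold gaussianDensity
  have h2 : Measurable (fun x : EuclideanSpace ℝ (Fin d) ↦
      ofLp (x - m) ⬝ᵥ S⁻¹ *ᵥ ofLp (x - m)) := by
    rw [this]; fun_prop
  fun_prop

/-- Linear change of variables by R = √S in the standard density: the Jacobian is det R = √(det S),
and S⁻¹ evaluated at Rx gives ‖x‖². -/
lemma multivariateGaussian_eq_withDensity (m : EuclideanSpace ℝ (Fin d))
    {S : Matrix (Fin d) (Fin d) ℝ} (hS : S.PosDef) :
    multivariateGaussian m S
      = volume.withDensity (fun x ↦ ENNReal.ofReal (gaussianDensity m S x)) := by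
  set R := CFC.sqrt S with hR
  have hRS : R * R = S := CFC.sqrt_mul_sqrt_self S hS.posSemidef.nonneg
  have hRt : Rᵀ = R := by
    have : Rᴴ = R := (CFC.sqrt_nonneg S).isSelfAdjoint
    rwa [conjTranspose_eq_transpose_of_trivial] at this
  have hdet : R.det = √S.det := by rw [hR, hS.posSemidef.det_sqrt]; simp
  have hdet0 : 0 < R.det := by rw [hdet]; exact Real.sqrt_pos.2 hS.det_pos
  have hunit : IsUnit R.det := hdet0.ne'.isUnit
  set L : EuclideanSpace ℝ (Fin d) →ₗ[ℝ] EuclideanSpace ℝ (Fin d) :=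
    (toEuclideanCLM (𝕜 := ℝ) R).toLinearMap with hL
  have hLdet : LinearMap.det L = R.det := by
    rw [hL, coe_toEuclideanCLM_eq_toEuclideanLin]
    exact LinearMap.det_toLin (PiLp.basisFun 2 ℝ (Fin d)) R
  have hmap := Measure.map_linearMap_addHaar_eq_smul_addHaar
    (volume : Measure (EuclideanSpace ℝ (Fin d))) (f := L) (by rw [hLdet]; exact hdet0.ne')
  have key : ∀ x : EuclideanSpace ℝ (Fin d), stdGaussianPDF _ x
      = R.det * gaussianDensity 0 S (L x) := by
    intro x
    have h1 : ofLp (L x) = R *ᵥ ofLp x := rfl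
    have h2 : ofLp (L x) ⬝ᵥ S⁻¹ *ᵥ ofLp (L x) = ‖x‖ ^ 2 := by
      rw [h1, norm_sq_eq_dotProduct, ← hRS, Matrix.mul_inv_rev, mulVec_mulVec, Matrix.mul_assoc,
        nonsing_inv_mul _ hunit, Matrix.mul_one, dotProduct_comm, dotProduct_mulVec,
        ← mulVec_transpose, mulVec_mulVec, hRt, mul_nonsing_inv _ hunit, one_mulVec]
    rw [gaussianDensity, sub_zero, h2, stdGaussianPDF, ← hdet, mul_inv_cancel_left₀ hdet0.ne']
    simp
  refine Measure.ext_of_lintegral _ fun f hf ↦ ?_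
  have hgm := measurable_gaussianDensity 0 S
  have hgm' := measurable_gaussianDensity m S
  have hsm := measurable_stdGaussianPDF (E := EuclideanSpace ℝ (Fin d))
  rw [multivariateGaussian, lintegral_map hf (by fun_prop), stdGaussian_eq_withDensity,
    lintegral_withDensity_eq_lintegral_mul _ (by fun_prop) (by fun_prop),
    lintegral_withDensity_eq_lintegral_mul _ (by fun_prop) (by fun_prop)]
  simp only [Pi.mul_apply]
  have hLm : Measurable L := (toEuclideanCLM (𝕜 := ℝ) R).continuous.measurable
  calc ∫⁻ x, ENNReal.ofReal (stdGaussianPDF _ x) * f (m + (toEuclideanCLM (𝕜 := ℝ) R) x)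
      = ∫⁻ x, ENNReal.ofReal R.det *
          (ENNReal.ofReal (gaussianDensity 0 S (L x)) * f (m + L x)) := by
        refine lintegral_congr fun x ↦ ?_
        rw [key, ENNReal.ofReal_mul hdet0.le, mul_assoc]
        rfl
    _ = ENNReal.ofReal R.det *
          ∫⁻ y, (ENNReal.ofReal (gaussianDensity 0 S y) * f (m + y)) ∂(volume.map L) := by
        rw [lintegral_map (by fun_prop) hLm, lintegral_const_mul]
        fun_prop
    _ = ∫⁻ y, (ENNReal.ofReal (gaussianDensity 0 S y) * f (m + y)) := by
        rw [hmap, lintegral_smul_measure, hLdet, smul_eq_mul, ← mul_assoc,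
          ← ENNReal.ofReal_mul hdet0.le, abs_of_pos (inv_pos.2 hdet0),
          mul_inv_cancel₀ hdet0.ne', ENNReal.ofReal_one, one_mul]
    _ = ∫⁻ y, (ENNReal.ofReal (gaussianDensity m S (m + y)) * f (m + y)) := by
        refine lintegral_congr fun y ↦ ?_
        simp [gaussianDensity]
    _ = _ := lintegral_add_left_eq_self (fun y ↦ ENNReal.ofReal (gaussianDensity m S y) * f y) m

lemma dotProduct_mulVec_eigenvector {S : Matrix (Fin d) (Fin d) ℝ} (hS : S.IsHermitian)
    (i : Fin d) :
    ofLp (hS.eigenvectorBasis i) ⬝ᵥ S *ᵥ ofLp (hS.eigenvectorBasis i) = hS.eigenvalues i := by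
  rw [hS.mulVec_eigenvectorBasis, dotProduct_smul, ← norm_sq_eq_dotProduct,
    hS.eigenvectorBasis.norm_eq_one]
  simp

lemma pow_le_det {S : Matrix (Fin d) (Fin d) ℝ} (hS : S.IsHermitian) {c : ℝ} (hc : 0 ≤ c)
    (h : ∀ v : Fin d → ℝ, c * (v ⬝ᵥ v) ≤ v ⬝ᵥ S *ᵥ v) : c ^ d ≤ S.det := by
  rw [hS.det_eq_prod_eigenvalues]
  have : c ^ d = ∏ _i : Fin d, c := by simp
  rw [this]
  simp only [RCLike.ofReal_real_eq_id, id_eq]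
  refine Finset.prod_le_prod (fun _ _ ↦ hc) fun i _ ↦ ?_
  have := h (ofLp (hS.eigenvectorBasis i))
  rwa [dotProduct_mulVec_eigenvector, ← norm_sq_eq_dotProduct, hS.eigenvectorBasis.norm_eq_one,
    one_pow, mul_one] at this

lemma det_le_one {S : Matrix (Fin d) (Fin d) ℝ} (hS : S.PosSemidef)
    (h : ∀ v : Fin d → ℝ, v ⬝ᵥ S *ᵥ v ≤ v ⬝ᵥ v) : S.det ≤ 1 := by
  rw [hS.1.det_eq_prod_eigenvalues]
  simp only [RCLike.ofReal_real_eq_id, id_eq]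
  refine Finset.prod_le_one (fun i _ ↦ hS.eigenvalues_nonneg i) fun i _ ↦ ?_
  have := h (ofLp (hS.1.eigenvectorBasis i))
  rwa [dotProduct_mulVec_eigenvector, ← norm_sq_eq_dotProduct, hS.1.eigenvectorBasis.norm_eq_one,
    one_pow] at this

/-- Conjugating by √A reduces to A = 1, where all eigenvalues of 1 + C with C positive semidefinite
are at least 1. -/
lemma det_le_det_add {A B : Matrix (Fin d) (Fin d) ℝ} (hA : A.PosDef) (hB : B.PosSemidef) :
    A.det ≤ (A + B).det := by
  set R := CFC.sqrt A with hR
  have hRA : R * R = A := CFC.sqrt_mul_sqrt_self A hA.posSemidef.nonneg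
  have hRt : Rᵀ = R := by
    have : Rᴴ = R := (CFC.sqrt_nonneg A).isSelfAdjoint
    rwa [conjTranspose_eq_transpose_of_trivial] at this
  have hdet : R.det = √A.det := by rw [hR, hA.posSemidef.det_sqrt]; simp
  have hunit : IsUnit R.det := by
    rw [hdet]; exact (Real.sqrt_pos.2 hA.det_pos).ne'.isUnit
  have hC : (R⁻¹ * B * R⁻¹).PosSemidef := by
    have := hB.mul_mul_conjTranspose_same R⁻¹
    rwa [conjTranspose_eq_transpose_of_trivial, transpose_nonsing_inv, hRt] at this
  have e : A + B = R * (1 + R⁻¹ * B * R⁻¹) * R := by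
    rw [Matrix.mul_add, Matrix.add_mul, Matrix.mul_one, hRA]
    congr 1
    rw [← Matrix.mul_assoc, ← Matrix.mul_assoc, mul_nonsing_inv _ hunit, Matrix.one_mul,
      Matrix.mul_assoc, nonsing_inv_mul _ hunit, Matrix.mul_one]
  have h1 : 1 ≤ (1 + R⁻¹ * B * R⁻¹).det := by
    have := pow_le_det (PosSemidef.one.add hC).1 zero_le_one (fun v ↦ by
      have := hC.dotProduct_mulVec_nonneg v
      rw [add_mulVec, dotProduct_add, one_mulVec, one_mul]
      simp only [star_trivial] at this
      linarith)
    simpa using this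
  rw [e, det_mul, det_mul, ← hRA, det_mul]
  have := mul_self_nonneg R.det
  nlinarith

/-- With w = S⁻¹v, both bounds come from nonnegative squares: (v−w)ᵀS(v−w) ≥ 0 for the lower one and
‖cw − v‖² ≥ 0 for the upper one. -/
lemma inv_quadratic_bounds {S : Matrix (Fin d) (Fin d) ℝ} (hS : S.PosDef) {c : ℝ} (hc : 0 < c)
    (hl : ∀ v : Fin d → ℝ, c * (v ⬝ᵥ v) ≤ v ⬝ᵥ S *ᵥ v)
    (hu : ∀ v : Fin d → ℝ, v ⬝ᵥ S *ᵥ v ≤ v ⬝ᵥ v) (v : Fin d → ℝ) :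
    v ⬝ᵥ v ≤ v ⬝ᵥ S⁻¹ *ᵥ v ∧ v ⬝ᵥ S⁻¹ *ᵥ v ≤ c⁻¹ * (v ⬝ᵥ v) := by
  have hunit : IsUnit S.det := hS.det_pos.ne'.isUnit
  set w := S⁻¹ *ᵥ v with hw
  have hSw : S *ᵥ w = v := by rw [hw, mulVec_mulVec, mul_nonsing_inv _ hunit, one_mulVec]
  have hwv : w ⬝ᵥ v = v ⬝ᵥ w := dotProduct_comm _ _
  have hSt : Sᵀ = S := by
    have : Sᴴ = S := hS.1
    rwa [conjTranspose_eq_transpose_of_trivial] at this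
  have hwS : w ⬝ᵥ S *ᵥ v = v ⬝ᵥ v := by
    rw [dotProduct_mulVec, ← mulVec_transpose, hSt, hSw]
  constructor
  · have h1 := hS.posSemidef.dotProduct_mulVec_nonneg (v - w)
    simp only [star_trivial, mulVec_sub, sub_dotProduct, dotProduct_sub, hSw, hwS] at h1
    have := hu v
    linarith
  · have h1 := hl w
    rw [hSw] at h1
    have h2 : 0 ≤ (c • w - v) ⬝ᵥ (c • w - v) := dotProduct_star_self_nonneg (c • w - v)
    simp only [sub_dotProduct, dotProduct_sub, smul_dotProduct, dotProduct_smul, smul_eq_mul] at h2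
    rw [hwv] at h1 h2
    rw [← div_eq_inv_mul, le_div_iff₀ hc]
    nlinarith [mul_le_mul_of_nonneg_left h1 hc.le]

/-- Comparison of a centered Gaussian density with the standard one. -/
lemma exists_density_multivariateGaussian {S : Matrix (Fin d) (Fin d) ℝ} (hS : S.PosDef) {c : ℝ}
    (hc : 0 < c) (hl : ∀ v : Fin d → ℝ, c * (v ⬝ᵥ v) ≤ v ⬝ᵥ S *ᵥ v)
    (hu : ∀ v : Fin d → ℝ, v ⬝ᵥ S *ᵥ v ≤ v ⬝ᵥ v) :
    ∃ G : EuclideanSpace ℝ (Fin d) → ℝ, Measurable G ∧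
      multivariateGaussian 0 S = (stdGaussian _).withDensity (fun x ↦ ENNReal.ofReal (G x)) ∧
      ∀ x, Real.exp (-((c⁻¹ - 1) / 2) * ‖x‖ ^ 2) ≤ G x ∧ G x ≤ (√(c ^ d))⁻¹ := by
  have hm := measurable_gaussianDensity 0 S
  have hm1 := measurable_stdGaussianPDF (E := EuclideanSpace ℝ (Fin d))
  refine ⟨fun x ↦ gaussianDensity 0 S x / stdGaussianPDF _ x, by fun_prop, ?_, fun x ↦ ?_⟩
  · rw [multivariateGaussian_eq_withDensity 0 hS, stdGaussian_eq_withDensity,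
      ← withDensity_mul _ (by fun_prop) (by fun_prop)]
    congr 1
    ext x
    rw [Pi.mul_apply, ← ENNReal.ofReal_mul (stdGaussianPDF_pos x).le,
      mul_div_cancel₀ _ (stdGaussianPDF_pos x).ne']
  · have e : gaussianDensity 0 S x / stdGaussianPDF _ x = (√S.det)⁻¹ *
        Real.exp (-(ofLp x ⬝ᵥ S⁻¹ *ᵥ ofLp x - ‖x‖ ^ 2) / 2) := by
      have h2 : Real.exp (-(ofLp x ⬝ᵥ S⁻¹ *ᵥ ofLp x - ‖x‖ ^ 2) / 2)
          = Real.exp (-(ofLp x ⬝ᵥ S⁻¹ *ᵥ ofLp x) / 2) / Real.exp (-‖x‖ ^ 2 / 2) := by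
        rw [← Real.exp_sub]; ring_nf
      rw [h2, gaussianDensity, stdGaussianPDF, finrank_euclideanSpace, Fintype.card_fin, sub_zero]
      have : (0 : ℝ) < (2 * Real.pi) ^ (-(d / 2 : ℝ)) := by positivity
      field_simp
    simp only [e]
    obtain ⟨h1, h2⟩ := inv_quadratic_bounds hS hc hl hu (ofLp x)
    rw [← norm_sq_eq_dotProduct] at h1 h2
    have hd0 : 0 < √S.det := Real.sqrt_pos.2 hS.det_pos
    have hd1 : √S.det ≤ 1 := Real.sqrt_le_one.2 (det_le_one hS.posSemidef hu)
    have hdc : √(c ^ d) ≤ √S.det := Real.sqrt_le_sqrt (pow_le_det hS.1 hc.le hl)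
    have hc0 : 0 < √(c ^ d) := Real.sqrt_pos.2 (by positivity)
    constructor
    · calc Real.exp (-((c⁻¹ - 1) / 2) * ‖x‖ ^ 2)
          ≤ Real.exp (-(ofLp x ⬝ᵥ S⁻¹ *ᵥ ofLp x - ‖x‖ ^ 2) / 2) :=
            Real.exp_le_exp.2 (by linarith)
        _ ≤ _ := le_mul_of_one_le_left (Real.exp_pos _).le ((one_le_inv₀ hd0).2 hd1)
    · calc (√S.det)⁻¹ * Real.exp (-(ofLp x ⬝ᵥ S⁻¹ *ᵥ ofLp x - ‖x‖ ^ 2) / 2)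
          ≤ (√S.det)⁻¹ * 1 := by
            refine mul_le_mul_of_nonneg_left (Real.exp_le_one_iff.2 (by linarith)) (by positivity)
        _ ≤ (√(c ^ d))⁻¹ := by
            rw [mul_one]
            exact inv_anti₀ hc0 hdc

end GaussianMatrix

/-! ### Differential entropy as a Gaussian value minus a divergence. -/

section Entropy

open Matrix WithLp InformationTheory

variable {d : ℕ}

lemma integral_ofLp {P : Measure (EuclideanSpace ℝ (Fin d))} (h : Integrable id P) (i : Fin d) :
    ∫ x, x i ∂P = (∫ x, x ∂P) i :=
  (EuclideanSpace.proj (𝕜 := ℝ) i).integral_comp_comm h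

lemma memLp_ofLp {P : Measure (EuclideanSpace ℝ (Fin d))} (h : MemLp id 2 P) (i : Fin d) :
    MemLp (fun x ↦ x i) 2 P :=
  (EuclideanSpace.proj (𝕜 := ℝ) i).comp_memLp' h

lemma integral_quadratic {P : Measure (EuclideanSpace ℝ (Fin d))} [IsProbabilityMeasure P]
    (h : MemLp id 2 P) (A : Matrix (Fin d) (Fin d) ℝ) :
    Integrable (fun x ↦ ofLp (x - ∫ y, y ∂P) ⬝ᵥ A *ᵥ ofLp (x - ∫ y, y ∂P)) P ∧
    ∫ x, ofLp (x - ∫ y, y ∂P) ⬝ᵥ A *ᵥ ofLp (x - ∫ y, y ∂P) ∂P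
      = ∑ i, ∑ j, A i j * covMat P i j := by
  set m := ∫ y, y ∂P with hm
  have h1 : Integrable id P := h.integrable (by norm_num)
  have hi : ∀ i, MemLp (fun x : EuclideanSpace ℝ (Fin d) ↦ x i - m i) 2 P := fun i ↦
    (memLp_ofLp h i).sub (memLp_const _)
  have hij : ∀ i j, Integrable (fun x : EuclideanSpace ℝ (Fin d) ↦
      A i j * ((x i - m i) * (x j - m j))) P := fun i j ↦
    ((hi i).integrable_mul (hi j)).const_mul _
  have e : (fun x ↦ ofLp (x - m) ⬝ᵥ A *ᵥ ofLp (x - m))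
      = fun x ↦ ∑ i, ∑ j, A i j * ((x i - m i) * (x j - m j)) := by
    ext x
    simp only [dotProduct, mulVec, Finset.mul_sum]
    refine Finset.sum_congr rfl fun i _ ↦ Finset.sum_congr rfl fun j _ ↦ ?_
    simp
    ring
  rw [e]
  refine ⟨integrable_finsetSum _ fun i _ ↦ integrable_finsetSum _ fun j _ ↦ hij i j, ?_⟩
  rw [integral_finsetSum _ fun i _ ↦ integrable_finsetSum _ fun j _ ↦ hij i j]
  refine Finset.sum_congr rfl fun i _ ↦ ?_
  rw [integral_finsetSum _ fun j _ ↦ hij i j]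
  refine Finset.sum_congr rfl fun j _ ↦ ?_
  rw [integral_const_mul, covMat, Matrix.of_apply, covariance, integral_ofLp h1, integral_ofLp h1]

lemma covMat_isSymm (P : Measure (EuclideanSpace ℝ (Fin d))) : (covMat P)ᵀ = covMat P := by
  ext i j
  simp only [covMat, transpose_apply, Matrix.of_apply]
  exact covariance_comm _ _

lemma log_gaussianDensity (m : EuclideanSpace ℝ (Fin d)) {S : Matrix (Fin d) (Fin d) ℝ}
    (hS : S.PosDef) (x : EuclideanSpace ℝ (Fin d)) :
    Real.log (gaussianDensity m S x) = -(1 / 2 * Real.log ((2 * Real.pi) ^ d * S.det)) -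
      1 / 2 * (ofLp (x - m) ⬝ᵥ S⁻¹ *ᵥ ofLp (x - m)) := by
  have hd := hS.det_pos
  have e : Real.log ((2 * Real.pi) ^ d * S.det) = d * Real.log (2 * Real.pi) + Real.log S.det := by
    rw [Real.log_mul (by positivity) (by positivity), Real.log_pow]
  rw [e, gaussianDensity, Real.log_mul (by positivity) (by positivity),
    Real.log_mul (by positivity) (by positivity), Real.log_exp, Real.log_inv,
    Real.log_sqrt hd.le, Real.log_rpow (by positivity)]
  ring

/-- The differential entropy in terms of the divergence from the Gaussian with the same
covariance. -/
lemma diffEntropy_eq_sub_klDiv {P : Measure (EuclideanSpace ℝ (Fin d))} [IsProbabilityMeasure P]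
    (hac : P ≪ volume) (h2 : MemLp id 2 P) (hS : (covMat P).PosDef) :
    diffEntropy P
      = ((1 / 2 * Real.log ((2 * Real.pi * Real.exp 1) ^ d * (covMat P).det) : ℝ) : EReal)
        - ((klDiv P (multivariateGaussian (∫ x, x ∂P) (covMat P)) : ℝ≥0∞) : EReal) := by
  set S := covMat P with hSdef
  set m := ∫ x, x ∂P with hm
  set ν := multivariateGaussian m S with hν
  set H := 1 / 2 * Real.log ((2 * Real.pi * Real.exp 1) ^ d * S.det) with hH
  set q := gaussianDensity m S with hq
  have hqm : Measurable q := measurable_gaussianDensity m S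
  have hq0 : ∀ x, 0 < q x := gaussianDensity_pos m hS
  have hνq : ν = volume.withDensity (fun x ↦ ENNReal.ofReal (q x)) :=
    multivariateGaussian_eq_withDensity m hS
  have hvν : (volume : Measure (EuclideanSpace ℝ (Fin d))) ≪ ν := by
    rw [hνq]
    exact withDensity_absolutelyContinuous' (by fun_prop)
      (ae_of_all _ fun x ↦ (ENNReal.ofReal_pos.2 (hq0 x)).ne')
  have hPν : P ≪ ν := hac.trans hvν
  set p : EuclideanSpace ℝ (Fin d) → ℝ := fun x ↦ (P.rnDeriv volume x).toReal with hp
  have hpm : Measurable p := (P.measurable_rnDeriv volume).ennreal_toReal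
  have hp0 : ∀ x, 0 ≤ p x := fun x ↦ ENNReal.toReal_nonneg
  obtain ⟨hQi, hQ⟩ := integral_quadratic h2 S⁻¹
  rw [← hm] at hQi hQ
  have hQd : ∑ i, ∑ j, S⁻¹ i j * S i j = d := by
    have : (S⁻¹ * S).trace = d := by
      rw [nonsing_inv_mul _ hS.det_pos.ne'.isUnit]; simp
    rw [← this, Matrix.trace]
    refine Finset.sum_congr rfl fun i _ ↦ ?_
    rw [diag_apply, mul_apply]
    refine Finset.sum_congr rfl fun j _ ↦ ?_
    conv_lhs => rw [hSdef, ← covMat_isSymm P, transpose_apply, covMat_isSymm P]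
  have hlogq : Integrable (fun x ↦ Real.log (q x)) P := by
    simp_rw [hq, log_gaussianDensity m hS]
    exact (integrable_const _).sub (hQi.const_mul _)
  -- log q is quadratic, so its P-mean depends only on mean and covariance: the quadratic form
  -- averages to tr(S⁻¹S) = d, which accounts for the factor e^d inside the logarithm.
  have hlogq_int : ∫ x, Real.log (q x) ∂P = -H := by
    simp_rw [hq, log_gaussianDensity m hS]
    rw [integral_sub (integrable_const _) (hQi.const_mul _), integral_const_mul, hQ, hQd, hH]
    have hd := hS.det_pos
    have e : Real.log ((2 * Real.pi * Real.exp 1) ^ d * S.det)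
        = Real.log ((2 * Real.pi) ^ d * S.det) + d := by
      rw [mul_pow, mul_right_comm, Real.log_mul (by positivity) (by positivity), Real.log_pow,
        Real.log_exp, mul_one]
    rw [e]
    simp
    ring
  have hllr : llr P ν =ᵐ[P] fun x ↦ Real.log (p x) - Real.log (q x) := by
    have h3 := hac.ae_le (Measure.rnDeriv_withDensity_right P volume
      (f := fun x ↦ ENNReal.ofReal (q x)) (by fun_prop)
      (ae_of_all _ fun x ↦ (ENNReal.ofReal_pos.2 (hq0 x)).ne')
      (ae_of_all _ fun x ↦ ENNReal.ofReal_ne_top))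
    filter_upwards [h3, Measure.rnDeriv_pos hac, hac.ae_le (P.rnDeriv_lt_top volume)] with
      x hx hx1 hx2
    have hx0 : 0 < (P.rnDeriv volume x).toReal := ENNReal.toReal_pos hx1.ne' hx2.ne
    rw [llr, hνq, hx, ENNReal.toReal_mul, ENNReal.toReal_inv, ENNReal.toReal_ofReal (hq0 x).le,
      Real.log_mul (inv_ne_zero (hq0 x).ne') hx0.ne', Real.log_inv]
    ring
  have hint_iff : Integrable (llr P ν) P ↔ Integrable (fun x ↦ Real.log (p x)) P := by
    rw [integrable_congr hllr]
    constructor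
    · intro h
      refine (h.add hlogq).congr (ae_of_all _ fun x ↦ ?_)
      simp
    · exact fun h ↦ h.sub hlogq
  have hN : ∀ x, Real.negMulLog (p x) = -(p x • Real.log (p x)) := fun x ↦ by
    simp [Real.negMulLog]
  have hN_iff : Integrable (fun x ↦ Real.negMulLog (p x)) volume ↔
      Integrable (fun x ↦ Real.log (p x)) P := by
    rw [← integrable_rnDeriv_smul_iff hac, ← integrable_neg_iff]
    refine integrable_congr (ae_of_all _ fun x ↦ ?_)
    rw [Pi.neg_apply, hN x, neg_neg]
  have hNm : Measurable (fun x ↦ Real.negMulLog (p x)) :=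
    Real.continuous_negMulLog.measurable.comp hpm
  rw [diffEntropy, if_pos hac]
  change ((∫⁻ x, ENNReal.ofReal (Real.negMulLog (p x)) : ℝ≥0∞) : EReal) -
      ((∫⁻ x, ENNReal.ofReal (-Real.negMulLog (p x)) : ℝ≥0∞) : EReal) = _
  by_cases hi : Integrable (llr P ν) P
  · have hNi := hN_iff.2 (hint_iff.1 hi)
    have hlog := hint_iff.1 hi
    have hpos := hNi.lintegral_lt_top
    have hneg := hNi.neg.lintegral_lt_top
    simp only [Pi.neg_apply] at hneg
    have hkl := klDiv_ne_top hPν hi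
    rw [← ENNReal.ofReal_toReal hpos.ne, ← ENNReal.ofReal_toReal hneg.ne,
      ← ENNReal.ofReal_toReal hkl, EReal.coe_ennreal_ofReal, EReal.coe_ennreal_ofReal,
      EReal.coe_ennreal_ofReal, max_eq_left ENNReal.toReal_nonneg,
      max_eq_left ENNReal.toReal_nonneg, max_eq_left ENNReal.toReal_nonneg, ← EReal.coe_sub,
      ← EReal.coe_sub]
    congr 1
    rw [← integral_eq_lintegral_pos_part_sub_lintegral_neg_part hNi,
      toReal_klDiv_of_measure_eq hPν (by simp), integral_congr_ae hllr,
      integral_sub hlog hlogq, hlogq_int]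
    simp_rw [hN]
    rw [integral_neg, integral_rnDeriv_smul hac]
    ring
  · rw [klDiv_of_not_integrable hi]
    -- The divergence is infinite here, so the entropy must be shown to be −∞. The positive part of
    -- −p ln p always has finite integral, so only its negative part can destroy integrability.
    have htop : ∫⁻ x, ENNReal.ofReal (-Real.negMulLog (p x)) = ⊤ := by
      by_contra hne
      refine hi (hint_iff.2 (hN_iff.1 ?_))
      have hpq : Integrable (fun x ↦ p x * |Real.log (q x)|) volume := by
        have := (integrable_rnDeriv_smul_iff hac (f := fun x ↦ |Real.log (q x)|)).2 hlogq.abs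
        simpa [hp] using this
      have hqi : ∫⁻ x, ENNReal.ofReal (q x) = 1 := by
        have : ν Set.univ = 1 := measure_univ
        rwa [hνq, withDensity_apply _ MeasurableSet.univ, Measure.restrict_univ] at this
      -- Gibbs' inequality in pointwise form: q · klFun(p/q) ≥ 0 bounds −p ln p by −p ln q + q − p.
      have hle : ∀ x, ENNReal.ofReal (Real.negMulLog (p x))
          ≤ ENNReal.ofReal (p x * |Real.log (q x)|) + ENNReal.ofReal (q x) := by
        intro x
        rw [← ENNReal.ofReal_add (by have := hp0 x; positivity) (hq0 x).le]
        refine ENNReal.ofReal_le_ofReal ?_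
        rcases (hp0 x).eq_or_lt with h0 | h0
        · rw [← h0]; simp [(hq0 x).le]
        · have h3 := mul_nonneg (hq0 x).le (klFun_nonneg (div_pos h0 (hq0 x)).le)
          have h4 : q x * klFun (p x / q x)
              = -Real.negMulLog (p x) - p x * Real.log (q x) + q x - p x := by
            rw [klFun_apply, Real.log_div h0.ne' (hq0 x).ne', Real.negMulLog]
            have := (hq0 x).ne'
            field_simp
          have h5 := mul_le_mul_of_nonneg_left (neg_le_abs (Real.log (q x))) h0.le
          linarith
      have hfin : ∫⁻ x, ENNReal.ofReal (Real.negMulLog (p x)) ≠ ⊤ := by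
        refine ne_top_of_le_ne_top ?_ (lintegral_mono hle)
        rw [lintegral_add_left (by fun_prop), hqi]
        exact ENNReal.add_ne_top.2 ⟨hpq.lintegral_lt_top.ne, ENNReal.one_ne_top⟩
      refine ⟨hNm.aestronglyMeasurable, ?_⟩
      have e : ∀ x, ‖Real.negMulLog (p x)‖ₑ = ENNReal.ofReal (Real.negMulLog (p x)) +
          ENNReal.ofReal (-Real.negMulLog (p x)) := by
        intro x
        rw [Real.enorm_eq_ofReal_abs]
        rcases le_total 0 (Real.negMulLog (p x)) with h | h
        · rw [abs_of_nonneg h, ENNReal.ofReal_of_nonpos (neg_nonpos.2 h), add_zero]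
        · rw [abs_of_nonpos h, ENNReal.ofReal_of_nonpos h, zero_add]
      rw [HasFiniteIntegral]
      simp_rw [e]
      rw [lintegral_add_left (by fun_prop)]
      exact ENNReal.add_lt_top.2 ⟨hfin.lt_top, lt_top_iff_ne_top.2 hne⟩
    rw [htop, EReal.coe_ennreal_top, EReal.sub_top, EReal.sub_top]

/-- Gaussian measures maximize the differential entropy at a given covariance. -/
lemma diffEntropy_le {P : Measure (EuclideanSpace ℝ (Fin d))} [IsProbabilityMeasure P]
    (h2 : MemLp id 2 P) (hS : (covMat P).PosDef) :
    diffEntropy P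
      ≤ ((1 / 2 * Real.log ((2 * Real.pi * Real.exp 1) ^ d * (covMat P).det) : ℝ) : EReal) := by
  by_cases hac : P ≪ volume
  · rw [diffEntropy_eq_sub_klDiv hac h2 hS]
    exact EReal.sub_le_of_le_add (le_add_of_nonneg_right (EReal.coe_ennreal_nonneg _))
  · rw [diffEntropy, if_neg hac]
    exact bot_le

end Entropy

/-! ### Convolution, covariance, and density bounds. -/

section Convolution

open Matrix WithLp InformationTheory

/-- Data processing: adjoining an independent copy of ν leaves the divergence unchanged, and
addition is a measurable map. -/
lemma klDiv_conv_right_le {E : Type*} [AddCommMonoid E] [MeasurableSpace E] [MeasurableAdd₂ E]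
    (μ μ' ν : Measure E) [IsFiniteMeasure μ] [IsFiniteMeasure μ'] [IsProbabilityMeasure ν] :
    klDiv (μ.conv ν) (μ'.conv ν) ≤ klDiv μ μ' := by
  have h : ∀ m : Measure E, IsFiniteMeasure m →
      m.conv ν = (m ⊗ₘ Kernel.const E ν).map (fun x ↦ x.1 + x.2) := by
    intro m hm
    rw [Measure.compProd_const, Measure.conv]
  rw [h μ inferInstance, h μ' inferInstance]
  exact (klDiv_map_le _ _ (by fun_prop)).trans (klDiv_compProd_left μ μ' _).le

lemma withDensity_map {α β : Type*} [MeasurableSpace α] [MeasurableSpace β] (μ : Measure α)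
    {T : α → β} (hT : Measurable T) {f : β → ℝ≥0∞} (hf : Measurable f) :
    (μ.map T).withDensity f = (μ.withDensity (fun x ↦ f (T x))).map T := by
  ext s hs
  rw [withDensity_apply _ hs, setLIntegral_map hs hf hT, Measure.map_apply hT hs,
    withDensity_apply _ (hT hs)]

variable {d : ℕ}

lemma memLp_id_conv {μ ν : Measure (EuclideanSpace ℝ (Fin d))} [IsProbabilityMeasure μ]
    [IsProbabilityMeasure ν] (hμ : MemLp id 2 μ) (hν : MemLp id 2 ν) :
    MemLp id 2 (μ.conv ν) := by
  rw [Measure.conv, memLp_map_measure_iff (by fun_prop) (by fun_prop)]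
  exact (hμ.comp_fst ν).add (hν.comp_snd μ)

lemma integral_id_conv {μ ν : Measure (EuclideanSpace ℝ (Fin d))} [IsProbabilityMeasure μ]
    [IsProbabilityMeasure ν] (hμ : Integrable id μ) (hν : Integrable id ν) :
    ∫ x, x ∂(μ.conv ν) = ∫ x, x ∂μ + ∫ x, x ∂ν := by
  rw [Measure.conv, integral_map (by fun_prop) (by fun_prop)]
  refine (integral_add (hμ.comp_fst ν) (hν.comp_snd μ)).trans ?_
  rw [integral_fun_fst, integral_fun_snd]
  simp

lemma covMat_conv {μ ν : Measure (EuclideanSpace ℝ (Fin d))} [IsProbabilityMeasure μ]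
    [IsProbabilityMeasure ν] (hμ : MemLp id 2 μ) (hν : MemLp id 2 ν) :
    covMat (μ.conv ν) = covMat μ + covMat ν := by
  ext i j
  have h1 : ∀ i, MemLp (fun x : EuclideanSpace ℝ (Fin d) × EuclideanSpace ℝ (Fin d) ↦ x.1 i) 2
      (μ.prod ν) := fun i ↦ (memLp_ofLp hμ i).comp_fst ν
  have h2 : ∀ i, MemLp (fun x : EuclideanSpace ℝ (Fin d) × EuclideanSpace ℝ (Fin d) ↦ x.2 i) 2
      (μ.prod ν) := fun i ↦ (memLp_ofLp hν i).comp_snd μ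
  have e1 : cov[fun x ↦ x.1 i, fun x ↦ x.1 j; μ.prod ν] = cov[fun x ↦ x i, fun x ↦ x j; μ] := by
    have := covariance_map (μ := μ.prod ν) (Z := Prod.fst)
      (X := fun x : EuclideanSpace ℝ (Fin d) ↦ x i) (Y := fun x ↦ x j) (by fun_prop) (by fun_prop)
      (by fun_prop)
    rw [← Measure.fst, Measure.fst_prod] at this
    exact this.symm
  have e2 : cov[fun x ↦ x.2 i, fun x ↦ x.2 j; μ.prod ν] = cov[fun x ↦ x i, fun x ↦ x j; ν] := by
    have := covariance_map (μ := μ.prod ν) (Z := Prod.snd)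
      (X := fun x : EuclideanSpace ℝ (Fin d) ↦ x i) (Y := fun x ↦ x j) (by fun_prop) (by fun_prop)
      (by fun_prop)
    rw [← Measure.snd, Measure.snd_prod] at this
    exact this.symm
  have e3 : ∀ i j, cov[fun x ↦ x.1 i, fun x ↦ x.2 j; μ.prod ν] = 0 := fun i j ↦
    covariance_fst_snd_prod (memLp_ofLp hμ i) (memLp_ofLp hν j)
  have e4 : cov[fun x ↦ x.2 i, fun x ↦ x.1 j; μ.prod ν] = 0 := by rw [covariance_comm, e3]
  simp only [covMat, Matrix.of_apply, Matrix.add_apply]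
  rw [Measure.conv, covariance_map_fun (by fun_prop) (by fun_prop) (by fun_prop)]
  change cov[(fun x ↦ x.1 i) + (fun x ↦ x.2 i), (fun x ↦ x.1 j) + (fun x ↦ x.2 j); μ.prod ν] = _
  rw [covariance_add_left (h1 i) (h2 i) ((h1 j).add (h2 j)),
    covariance_add_right (h1 i) (h1 j) (h2 j), covariance_add_right (h2 i) (h1 j) (h2 j),
    e1, e2, e3, e4]
  ring

lemma covMat_multivariateGaussian (m : EuclideanSpace ℝ (Fin d)) {S : Matrix (Fin d) (Fin d) ℝ}
    (hS : S.PosSemidef) : covMat (multivariateGaussian m S) = S := by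
  ext i j
  exact covariance_eval_multivariateGaussian hS i j

lemma dotProduct_covMat_mulVec {P : Measure (EuclideanSpace ℝ (Fin d))} [IsProbabilityMeasure P]
    (h : MemLp id 2 P) (v : EuclideanSpace ℝ (Fin d)) :
    ∫ x, inner ℝ v (x - ∫ y, y ∂P) ^ 2 ∂P = ofLp v ⬝ᵥ covMat P *ᵥ ofLp v := by
  obtain ⟨-, h2⟩ := integral_quadratic h (vecMulVec (ofLp v) (ofLp v))
  have e : ∀ x : EuclideanSpace ℝ (Fin d),
      ofLp x ⬝ᵥ vecMulVec (ofLp v) (ofLp v) *ᵥ ofLp x = inner ℝ v x ^ 2 := by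
    intro x
    rw [vecMulVec_mulVec, op_smul_eq_smul, dotProduct_smul, EuclideanSpace.inner_eq_star_dotProduct,
      star_trivial, smul_eq_mul, dotProduct_comm (ofLp v), pow_two]
  simp_rw [e] at h2
  rw [h2, dotProduct]
  refine Finset.sum_congr rfl fun i _ ↦ ?_
  rw [mulVec, dotProduct, Finset.mul_sum]
  refine Finset.sum_congr rfl fun j _ ↦ ?_
  rw [vecMulVec_apply]
  ring

lemma posSemidef_covMat {P : Measure (EuclideanSpace ℝ (Fin d))} [IsProbabilityMeasure P]
    (h : MemLp id 2 P) : (covMat P).PosSemidef := by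
  refine PosSemidef.of_dotProduct_mulVec_nonneg ?_ fun v ↦ ?_
  · rw [IsHermitian, conjTranspose_eq_transpose_of_trivial, covMat_isSymm]
  · have := dotProduct_covMat_mulVec h (toLp 2 v)
    rw [star_trivial]
    change v ⬝ᵥ covMat P *ᵥ v ≥ 0
    rw [ge_iff_le, ← show ofLp (toLp 2 v) = v from rfl, ← this]
    exact integral_nonneg fun x ↦ sq_nonneg _

/-- A probability measure at finite distance from `Q` has a density close to `1`. -/
lemma exists_density_of_linftyDist_le {P Q : Measure (EuclideanSpace ℝ (Fin d))}
    [IsProbabilityMeasure P] [IsProbabilityMeasure Q] {ε : ℝ} (hε : 0 ≤ ε)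
    (h : linftyDist P Q ≤ ENNReal.ofReal ε) :
    ∃ f : EuclideanSpace ℝ (Fin d) → ℝ, Measurable f ∧ (∀ x, 1 - ε ≤ f x) ∧ (∀ x, f x ≤ 1 + ε) ∧
      P = Q.withDensity (fun x ↦ ENNReal.ofReal (f x)) := by
  have hac : P ≪ Q := by
    by_contra hac
    rw [linftyDist, if_neg hac] at h
    exact absurd h (by simp)
  rw [linftyDist, if_pos hac, eLpNorm_exponent_top] at h
  -- Clamping the Radon-Nikodym derivative makes the almost everywhere bounds hold at every point.
  refine ⟨fun x ↦ max (1 - ε) (min (1 + ε) (P.rnDeriv Q x).toReal), by fun_prop,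
    fun x ↦ le_max_left _ _, fun x ↦ max_le (by linarith) (min_le_left _ _), ?_⟩
  have hd : P.HaveLebesgueDecomposition Q := Measure.haveLebesgueDecomposition_of_sigmaFinite P Q
  refine (Measure.withDensity_rnDeriv_eq P Q hac).symm.trans ?_
  refine withDensity_congr_ae ?_
  filter_upwards [enorm_ae_le_eLpNormEssSup (fun x ↦ (P.rnDeriv Q x).toReal - 1) Q,
    P.rnDeriv_lt_top Q] with x hx hx2
  have hx3 := hx.trans h
  rw [Real.enorm_eq_ofReal_abs, ENNReal.ofReal_le_ofReal_iff hε, abs_le] at hx3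
  rw [min_eq_right (by linarith), max_eq_right (by linarith), ENNReal.ofReal_toReal hx2.ne]

end Convolution

/-! ### Whitening, heat flow, and contraction near a Gaussian. -/

section Contraction

open Matrix WithLp InformationTheory Filter
open scoped MatrixOrder Topology

variable {d : ℕ}

lemma map_stdGaussian_toEuclideanCLM (M : Matrix (Fin d) (Fin d) ℝ) :
    (stdGaussian (EuclideanSpace ℝ (Fin d))).map (toEuclideanCLM (𝕜 := ℝ) M)
      = multivariateGaussian 0 (M * Mᵀ) := by
  rw [← multivariateGaussian_zero_one, map_multivariateGaussian_zero PosSemidef.one, Matrix.mul_one]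

lemma toEuclideanCLM_smul_apply (c : ℝ) (M : Matrix (Fin d) (Fin d) ℝ)
    (x : EuclideanSpace ℝ (Fin d)) :
    toEuclideanCLM (𝕜 := ℝ) (c • M) x = c • toEuclideanCLM (𝕜 := ℝ) M x := by
  rw [map_smul]; rfl

/-- Rescaling the Ornstein-Uhlenbeck evolution gives the heat flow. -/
lemma map_ouMeasure_conv_multivariateGaussian {ρ : ℝ} (h0 : 0 < ρ) (h1 : ρ ≤ 1)
    (μ : Measure (EuclideanSpace ℝ (Fin d))) [IsProbabilityMeasure μ]
    (A : Matrix (Fin d) (Fin d) ℝ) {T : Matrix (Fin d) (Fin d) ℝ} (hT : T.PosSemidef) :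
    ((ouMeasure ρ μ).map (toEuclideanCLM (𝕜 := ℝ) (ρ⁻¹ • A))).conv (multivariateGaussian 0 T)
      = (μ.map (toEuclideanCLM (𝕜 := ℝ) A)).conv
        (multivariateGaussian 0 (((1 - ρ ^ 2) / ρ ^ 2) • (A * Aᵀ) + T)) := by
  have hp : 0 ≤ (1 - ρ ^ 2) / ρ ^ 2 := div_nonneg (one_sub_sq_nonneg h0.le h1) (sq_nonneg _)
  have hAA : (A * Aᵀ).PosSemidef := by
    have := posSemidef_self_mul_conjTranspose A
    rwa [conjTranspose_eq_transpose_of_trivial] at this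
  have : IsProbabilityMeasure (μ.map (toEuclideanCLM (𝕜 := ℝ) A)) :=
    Measure.isProbabilityMeasure_map (by fun_prop)
  rw [ouMeasure, Measure.map_conv_continuousLinearMap, Measure.map_map (by fun_prop) (by fun_prop),
    Measure.map_map (by fun_prop) (by fun_prop)]
  have e1 : (toEuclideanCLM (𝕜 := ℝ) (ρ⁻¹ • A)) ∘ (fun x ↦ ρ • x)
      = toEuclideanCLM (𝕜 := ℝ) A := by
    ext1 x
    rw [Function.comp_apply, toEuclideanCLM_smul_apply, map_smul, smul_smul,
      inv_mul_cancel₀ h0.ne', one_smul]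
  have e2 : (toEuclideanCLM (𝕜 := ℝ) (ρ⁻¹ • A)) ∘ (fun x ↦ √(1 - ρ ^ 2) • x)
      = toEuclideanCLM (𝕜 := ℝ) ((√(1 - ρ ^ 2) / ρ) • A) := by
    ext1 x
    rw [Function.comp_apply, toEuclideanCLM_smul_apply, toEuclideanCLM_smul_apply, map_smul,
      smul_smul, div_eq_inv_mul]
  rw [e1, e2, map_stdGaussian_toEuclideanCLM, Measure.conv_assoc]
  have e3 : (√(1 - ρ ^ 2) / ρ) • A * ((√(1 - ρ ^ 2) / ρ) • A)ᵀ
      = ((1 - ρ ^ 2) / ρ ^ 2) • (A * Aᵀ) := by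
    rw [transpose_smul, Matrix.smul_mul, Matrix.mul_smul, smul_smul, div_mul_div_comm,
      Real.mul_self_sqrt (one_sub_sq_nonneg h0.le h1), pow_two ρ]
  rw [e3, multivariateGaussian_conv (hAA.smul hp) hT]

lemma integral_withDensity_ofReal {Ω : Type*} [MeasurableSpace Ω] {μ : Measure Ω} {F : Ω → ℝ}
    (hF : Measurable F) (h0 : ∀ x, 0 ≤ F x) (g : Ω → ℝ) :
    ∫ x, g x ∂(μ.withDensity fun x ↦ ENNReal.ofReal (F x)) = ∫ x, F x * g x ∂μ := by
  rw [integral_withDensity_eq_integral_toReal_smul (by fun_prop) (by simp)]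
  simp [ENNReal.toReal_ofReal, h0]

/-- Bounded densities keep linear and quadratic test functions integrable, so matching moments
become orthogonality; equal total mass gives the constant term. -/
lemma orthQuadratic_sub_of_moments {E : Type*} [NormedAddCommGroup E] [InnerProductSpace ℝ E]
    [FiniteDimensional ℝ E] [MeasurableSpace E] [BorelSpace E] {F G : E → ℝ} {C : ℝ}
    (hF : Measurable F) (hG : Measurable G) (hF0 : ∀ x, 0 ≤ F x) (hG0 : ∀ x, 0 ≤ G x)
    (hFC : ∀ x, F x ≤ C) (hGC : ∀ x, G x ≤ C)
    {μ ν : Measure E} [IsProbabilityMeasure μ] [IsProbabilityMeasure ν]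
    (hμ : μ = (stdGaussian E).withDensity fun x ↦ ENNReal.ofReal (F x))
    (hν : ν = (stdGaussian E).withDensity fun x ↦ ENNReal.ofReal (G x))
    (h1 : ∀ v, ∫ x, inner ℝ v x ∂μ = ∫ x, inner ℝ v x ∂ν)
    (h2 : ∀ v, ∫ x, inner ℝ v x ^ 2 ∂μ = ∫ x, inner ℝ v x ^ 2 ∂ν) :
    OrthQuadratic (fun x ↦ F x - G x) := by
  have key : ∀ g : E → ℝ, Integrable g (stdGaussian E) → ∫ x, g x ∂μ = ∫ x, g x ∂ν →
      ∫ x, (F x - G x) * g x ∂(stdGaussian E) = 0 := by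
    intro g hg h
    have hFg : Integrable (fun x ↦ F x * g x) (stdGaussian E) :=
      hg.bdd_mul (c := C) hF.aestronglyMeasurable
        (ae_of_all _ fun x ↦ by rw [Real.norm_of_nonneg (hF0 x)]; exact hFC x)
    have hGg : Integrable (fun x ↦ G x * g x) (stdGaussian E) :=
      hg.bdd_mul (c := C) hG.aestronglyMeasurable
        (ae_of_all _ fun x ↦ by rw [Real.norm_of_nonneg (hG0 x)]; exact hGC x)
    simp_rw [sub_mul]
    rw [integral_sub hFg hGg, ← integral_withDensity_ofReal hF hF0,
      ← integral_withDensity_ofReal hG hG0, ← hμ, ← hν, h, sub_self]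
  refine ⟨?_, fun v ↦ key _ (integrable_inner_stdGaussian v) (h1 v),
    fun v ↦ key _ (integrable_inner_sq_stdGaussian v) (h2 v)⟩
  simpa using key (fun _ ↦ 1) (integrable_const _) (by simp)

/-- All the required inequalities are strict at ε = 0 and continuous there, apart from ε > 0 itself.
The bound by u secures room for the noise; the last three feed the density estimates in whitened
coordinates. -/
lemma exists_small_perturbation (n : ℕ) {η b u : ℝ} (hη : 0 < η) (hb : b < u) :
    ∃ ε : ℝ, 0 < ε ∧ ε < 1 ∧ b * (1 + ε) ≤ u ∧ (1 + η)⁻¹ ≤ 1 - ε ∧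
      (1 + ε) * (√(((1 - ε) / (1 + ε)) ^ n))⁻¹ ≤ 1 + η ∧
      (((1 - ε) / (1 + ε))⁻¹ - 1) / 2 ≤ η := by
  have c1 : ContinuousAt (fun ε : ℝ ↦ b * (1 + ε)) 0 := by fun_prop
  have c2 : ContinuousAt (fun ε : ℝ ↦ 1 - ε) 0 := by fun_prop
  have c0 : ContinuousAt (fun ε : ℝ ↦ (1 - ε) / (1 + ε)) 0 :=
    ContinuousAt.div (by fun_prop) (by fun_prop) (by norm_num)
  have c3 : ContinuousAt (fun ε : ℝ ↦ (1 + ε) * (√(((1 - ε) / (1 + ε)) ^ n))⁻¹) 0 := by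
    refine ContinuousAt.mul (by fun_prop) (ContinuousAt.inv₀ ?_ (by simp))
    exact Real.continuous_sqrt.continuousAt.comp (c0.pow n)
  have c4 : ContinuousAt (fun ε : ℝ ↦ (((1 - ε) / (1 + ε))⁻¹ - 1) / 2) 0 :=
    ((c0.inv₀ (by norm_num)).sub continuousAt_const).div_const 2
  have e1 := c1.eventually_lt (continuousAt_const (y := u)) (by simpa using hb)
  have e2 := (continuousAt_const (y := (1 + η)⁻¹)).eventually_lt c2
    (by rw [sub_zero]; exact inv_lt_one_of_one_lt₀ (by linarith))
  have e3 := c3.eventually_lt (continuousAt_const (y := 1 + η)) (by simpa using hη)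
  have e4 := c4.eventually_lt (continuousAt_const (y := η)) (by simpa using hη)
  have e5 := (continuousAt_id (x := (0 : ℝ))).eventually_lt (continuousAt_const (y := (1 : ℝ)))
    (by simp)
  obtain ⟨ε, ⟨h1, h2, h3, h4, h5⟩, h6⟩ :=
    (((e1.and (e2.and (e3.and (e4.and e5)))).filter_mono nhdsWithin_le_nhds).and
      (self_mem_nhdsWithin (s := Set.Ioi (0 : ℝ)))).exists
  exact ⟨ε, h6, h5, h1.le, h2.le, h3.le, h4.le⟩

lemma memLp_id_withDensity {Q : Measure (EuclideanSpace ℝ (Fin d))} (hQ : MemLp id 2 Q) {C : ℝ}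
    {f : EuclideanSpace ℝ (Fin d) → ℝ} (hC : ∀ x, f x ≤ C) :
    MemLp id 2 (Q.withDensity fun x ↦ ENNReal.ofReal (f x)) := by
  refine hQ.of_measure_le_smul (c := ENNReal.ofReal C) ENNReal.ofReal_ne_top ?_
  rw [← withDensity_const]
  exact withDensity_mono (ae_of_all _ fun x ↦ ENNReal.ofReal_le_ofReal (hC x))

/-- The covariance of a centered perturbation of a centered Gaussian measure. -/
lemma covMat_withDensity_bounds {K : Matrix (Fin d) (Fin d) ℝ} (hK : K.PosSemidef) {l C : ℝ}
    (hl : 0 ≤ l) {f : EuclideanSpace ℝ (Fin d) → ℝ} (hf : Measurable f) (hlf : ∀ x, l ≤ f x)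
    (hfC : ∀ x, f x ≤ C) {P : Measure (EuclideanSpace ℝ (Fin d))} [IsProbabilityMeasure P]
    (hP : P = (multivariateGaussian 0 K).withDensity fun x ↦ ENNReal.ofReal (f x))
    (h0 : ∫ x, x ∂P = 0) (v : Fin d → ℝ) :
    l * (v ⬝ᵥ K *ᵥ v) ≤ v ⬝ᵥ covMat P *ᵥ v ∧ v ⬝ᵥ covMat P *ᵥ v ≤ C * (v ⬝ᵥ K *ᵥ v) := by
  have hγ : MemLp id 2 (multivariateGaussian (0 : EuclideanSpace ℝ (Fin d)) K) :=
    IsGaussian.memLp_two_id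
  have h2 : MemLp id 2 P := by rw [hP]; exact memLp_id_withDensity hγ hfC
  have e1 := dotProduct_covMat_mulVec h2 (toLp 2 v)
  have e2 := dotProduct_covMat_mulVec hγ (toLp 2 v)
  rw [covMat_multivariateGaussian 0 hK, integral_id_multivariateGaussian] at e2
  rw [h0] at e1
  simp only [sub_zero] at e1 e2
  have hI : Integrable (fun x ↦ inner ℝ (toLp 2 v) x ^ 2)
      (multivariateGaussian (0 : EuclideanSpace ℝ (Fin d)) K) :=
    ((innerSL ℝ (toLp 2 v)).comp_memLp' hγ).integrable_sq
  have hI2 : Integrable (fun x ↦ f x * inner ℝ (toLp 2 v) x ^ 2)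
      (multivariateGaussian (0 : EuclideanSpace ℝ (Fin d)) K) :=
    hI.bdd_mul (c := C) hf.aestronglyMeasurable
      (ae_of_all _ fun x ↦ by rw [Real.norm_of_nonneg (hl.trans (hlf x))]; exact hfC x)
  have e3 := integral_withDensity_ofReal
    (μ := multivariateGaussian (0 : EuclideanSpace ℝ (Fin d)) K) hf (fun x ↦ hl.trans (hlf x))
    (fun x ↦ inner ℝ (toLp 2 v) x ^ 2)
  rw [← hP, e1] at e3
  rw [e3, ← e2, ← integral_const_mul, ← integral_const_mul]
  exact ⟨integral_mono (hI.const_mul _) hI2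
      fun x ↦ mul_le_mul_of_nonneg_right (hlf x) (sq_nonneg _),
    integral_mono hI2 (hI.const_mul _) fun x ↦ mul_le_mul_of_nonneg_right (hfC x) (sq_nonneg _)⟩


lemma exists_heat_scale {u k : ℝ} (hu : 0 < u) (hk : 0 < k)
    (h : k < u / ((1 + u) ^ (1 / 3 : ℝ) - 1)) :
    ∃ s ρ : ℝ, 0 < s ∧ s * k < u ∧ 0 < ρ ∧ ρ < 1 ∧ (1 - ρ ^ 2) / ρ ^ 2 = s ∧
      (1 + u) * ρ ^ 6 < 1 := by
  set w := (1 + u) ^ (1 / 3 : ℝ) - 1 with hw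
  have hw3 : (1 + w) ^ 3 = 1 + u := by
    rw [hw, add_sub_cancel, ← Real.rpow_natCast, ← Real.rpow_mul (by positivity)]
    norm_num
  have hw0 : 0 < w := by
    have := Real.one_lt_rpow (x := 1 + u) (z := 1 / 3) (by linarith) (by norm_num)
    linarith
  have hwu : w < u / k := by
    rw [lt_div_iff₀ hw0] at h
    rw [lt_div_iff₀ hk]
    linarith
  -- s > (1+u)^{1/3} − 1 gives (1+s)³ > 1+u, hence enough contraction for ρ = (1+s)^{−1/2}; s < u/k
  -- keeps the heat increment below uI.
  obtain ⟨s, hs1, hs2⟩ := exists_between hwu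
  have hs : 0 < s := hw0.trans hs1
  have h1s : 0 < 1 + s := by linarith
  have hρ2 : ((√(1 + s))⁻¹) ^ 2 = (1 + s)⁻¹ := by rw [inv_pow, Real.sq_sqrt h1s.le]
  refine ⟨s, (√(1 + s))⁻¹, hs, (lt_div_iff₀ hk).1 hs2, by positivity, ?_, ?_, ?_⟩
  · refine inv_lt_one_of_one_lt₀ ?_
    rw [Real.lt_sqrt (by norm_num)]
    linarith
  · rw [hρ2]
    field_simp
    ring
  · have : ((√(1 + s))⁻¹) ^ 6 = ((1 + s) ^ 3)⁻¹ := by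
      rw [show 6 = 2 * 3 from rfl, pow_mul, hρ2, inv_pow]
    rw [this, ← div_eq_mul_inv, div_lt_one (by positivity), ← hw3]
    exact pow_lt_pow_left₀ (by linarith) (by linarith) (by norm_num)

lemma integral_inner_toEuclideanCLM {P : Measure (EuclideanSpace ℝ (Fin d))}
    [IsProbabilityMeasure P] (h : MemLp id 2 P) (h0 : ∫ x, x ∂P = 0)
    (M : Matrix (Fin d) (Fin d) ℝ) (v : EuclideanSpace ℝ (Fin d)) :
    ∫ x, inner ℝ v x ∂(P.map (toEuclideanCLM (𝕜 := ℝ) M)) = 0 ∧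
    ∫ x, inner ℝ v x ^ 2 ∂(P.map (toEuclideanCLM (𝕜 := ℝ) M))
      = (Mᵀ *ᵥ ofLp v) ⬝ᵥ covMat P *ᵥ (Mᵀ *ᵥ ofLp v) := by
  have e : ∀ x, inner ℝ v (toEuclideanCLM (𝕜 := ℝ) M x)
      = inner ℝ (toEuclideanCLM (𝕜 := ℝ) Mᵀ v) x := fun x ↦ by
    rw [inner_toEuclideanCLM_left, transpose_transpose]
  rw [integral_map (by fun_prop) (by fun_prop), integral_map (by fun_prop) (by fun_prop)]
  simp_rw [e]
  constructor
  · rw [integral_inner (f := fun x ↦ x) (h.integrable (by norm_num))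
      (toEuclideanCLM (𝕜 := ℝ) Mᵀ v), h0, inner_zero_right]
  · have := dotProduct_covMat_mulVec h (toEuclideanCLM (𝕜 := ℝ) Mᵀ v)
    rw [h0] at this
    simpa using this

/-- Near a Gaussian measure of small covariance, convolution with `γ_{uI}` contracts the divergence
from the Gaussian with the same covariance by the factor `1 + u`. -/
lemma exists_klDiv_conv_le {K : Matrix (Fin d) (Fin d) ℝ} (hK : K.PosDef) {u k : ℝ} (hu : 0 < u)
    (hk0 : 0 < k) (hk : ∀ v : Fin d → ℝ, v ⬝ᵥ K *ᵥ v ≤ k * (v ⬝ᵥ v))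
    (h : k < u / ((1 + u) ^ (1 / 3 : ℝ) - 1)) :
    ∃ ε : ℝ, 0 < ε ∧ ∀ P : Measure (EuclideanSpace ℝ (Fin d)), IsProbabilityMeasure P →
      linftyDist P (multivariateGaussian 0 K) ≤ ENNReal.ofReal ε → ∫ x, x ∂P = 0 →
        MemLp id 2 P ∧ (covMat P).PosDef ∧
        ENNReal.ofReal (1 + u) * klDiv (P.conv (multivariateGaussian 0 (u • 1)))
            ((multivariateGaussian 0 (covMat P)).conv (multivariateGaussian 0 (u • 1)))
          ≤ klDiv P (multivariateGaussian 0 (covMat P)) := by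
  obtain ⟨s, ρ, hs, hsk, hρ0, hρ1, hρs, hκ⟩ := exists_heat_scale hu hk0 h
  obtain ⟨η, hη, hmain⟩ := exists_klDiv_ouMeasure_le (EuclideanSpace ℝ (Fin d)) hρ0 hρ1
    (κ := 1 + u) (by linarith) hκ
  obtain ⟨ε, hε0, hε1, hεu, hεl, hεC, hεq⟩ := exists_small_perturbation d hη hsk
  refine ⟨ε, hε0, fun P hPp hPε hP0 ↦ ?_⟩
  obtain ⟨f, hf, hfl, hfu, hPf⟩ := exists_density_of_linftyDist_le hε0.le hPε
  -- Whitening by (aK)^{−1/2} rather than K^{−1/2} puts the covariances of both P and γ_K between c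
  -- and 1, so their Gaussians have bounded densities relative to the standard one.
  set a := 1 + ε with ha
  have ha0 : 0 < a := by linarith
  set c := (1 - ε) / a with hc
  have hc0 : 0 < c := div_pos (by linarith) ha0
  have h2 : MemLp id 2 P := by
    rw [hPf]; exact memLp_id_withDensity IsGaussian.memLp_two_id hfu
  have hcov := covMat_withDensity_bounds hK.posSemidef (sub_nonneg.2 hε1.le) hf hfl hfu hPf hP0
  set K' := covMat P with hK'
  have hK'p : K'.PosDef := by
    refine PosDef.of_dotProduct_mulVec_pos (posSemidef_covMat h2).isHermitian fun v hv ↦ ?_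
    have h1 := hK.dotProduct_mulVec_pos hv
    rw [star_trivial] at h1 ⊢
    exact (mul_pos (sub_pos.2 hε1) h1).trans_le (hcov v).1
  refine ⟨h2, hK'p, ?_⟩
  -- the whitening matrix
  set R := CFC.sqrt K with hR
  have hRK : R * R = K := CFC.sqrt_mul_sqrt_self K hK.posSemidef.nonneg
  have hRt : Rᵀ = R := by
    have : Rᴴ = R := (CFC.sqrt_nonneg K).isSelfAdjoint
    rwa [conjTranspose_eq_transpose_of_trivial] at this
  have hRdet : IsUnit R.det := by
    rw [isUnit_iff_ne_zero]
    intro h0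
    have := hK.det_pos
    rw [← hRK, det_mul, h0, zero_mul] at this
    exact lt_irrefl _ this
  set A := √a • R with hA
  set M := (√a)⁻¹ • R⁻¹ with hM
  have hsa : √a ≠ 0 := (Real.sqrt_pos.2 ha0).ne'
  have hMA : M * A = 1 := by
    rw [hM, hA, Matrix.smul_mul, Matrix.mul_smul, smul_smul, inv_mul_cancel₀ hsa,
      nonsing_inv_mul _ hRdet, one_smul]
  have hAM : A * M = 1 := mul_eq_one_comm.1 hMA
  have hAA : A * Aᵀ = a • K := by
    rw [hA, transpose_smul, hRt, Matrix.smul_mul, Matrix.mul_smul, smul_smul,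
      Real.mul_self_sqrt ha0.le, hRK]
  have hMK : M * K * Mᵀ = a⁻¹ • (1 : Matrix (Fin d) (Fin d) ℝ) := by
    have : K = a⁻¹ • (A * Aᵀ) := by rw [hAA, smul_smul, inv_mul_cancel₀ ha0.ne', one_smul]
    rw [this, Matrix.mul_smul, Matrix.smul_mul, ← Matrix.mul_assoc, hMA, Matrix.one_mul,
      ← transpose_mul, hMA, transpose_one]
  have hcomp : ∀ μ : Measure (EuclideanSpace ℝ (Fin d)),
      (μ.map (toEuclideanCLM (𝕜 := ℝ) M)).map (toEuclideanCLM (𝕜 := ℝ) A) = μ := by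
    intro μ
    rw [Measure.map_map (by fun_prop) (by fun_prop)]
    have : (toEuclideanCLM (𝕜 := ℝ) A) ∘ (toEuclideanCLM (𝕜 := ℝ) M) = id := by
      ext1 x
      have := congrArg (fun T ↦ T x) (map_mul (toEuclideanCLM (n := Fin d) (𝕜 := ℝ)) A M)
      simp only [hAM, map_one] at this
      exact this.symm
    rw [this, Measure.map_id]
  have hquad : ∀ (S : Matrix (Fin d) (Fin d) ℝ) (v : Fin d → ℝ),
      v ⬝ᵥ (M * S * Mᵀ) *ᵥ v = (Mᵀ *ᵥ v) ⬝ᵥ S *ᵥ (Mᵀ *ᵥ v) := by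
    intro S v
    rw [← mulVec_mulVec, ← mulVec_mulVec, dotProduct_mulVec v M, ← mulVec_transpose]
  have hMv : ∀ v : Fin d → ℝ, (Mᵀ *ᵥ v) ⬝ᵥ K *ᵥ (Mᵀ *ᵥ v) = a⁻¹ * (v ⬝ᵥ v) := by
    intro v
    rw [← hquad, hMK, smul_mulVec, one_mulVec, dotProduct_smul, smul_eq_mul]
  have hvv : ∀ v : Fin d → ℝ, 0 ≤ v ⬝ᵥ v := fun v ↦
    Finset.sum_nonneg fun i _ ↦ mul_self_nonneg _
  -- the whitened densities
  have hMu : IsUnit M := ⟨⟨M, A, hMA, hAM⟩, rfl⟩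
  set S := M * K' * Mᵀ with hS
  have hSp : S.PosDef := by
    have := hK'p.mul_mul_conjTranspose_same (B := M) (vecMul_injective_of_isUnit hMu)
    rwa [conjTranspose_eq_transpose_of_trivial] at this
  obtain ⟨G, hG, hGS, hGb⟩ := exists_density_multivariateGaussian hSp hc0
    (fun v ↦ by
      rw [hquad]
      refine le_trans (le_of_eq ?_) (hcov _).1
      rw [hMv, hc]; ring)
    (fun v ↦ by
      rw [hquad]
      refine (hcov _).2.trans (le_of_eq ?_)
      rw [hMv, ← mul_assoc, mul_inv_cancel₀ ha0.ne', one_mul])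
  have hIp : (a⁻¹ • (1 : Matrix (Fin d) (Fin d) ℝ)).PosDef := PosDef.one.smul (inv_pos.2 ha0)
  obtain ⟨g, hg, hgI, hgb⟩ := exists_density_multivariateGaussian hIp hc0
    (fun v ↦ by
      rw [smul_mulVec, one_mulVec, dotProduct_smul, smul_eq_mul]
      refine mul_le_mul_of_nonneg_right ?_ (hvv v)
      rw [hc, ← one_div]
      exact div_le_div_of_nonneg_right (by linarith) ha0.le)
    (fun v ↦ by
      rw [smul_mulVec, one_mulVec, dotProduct_smul, smul_eq_mul]
      exact mul_le_of_le_one_left (hvv v) (inv_le_one_of_one_le₀ (by linarith)))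
  set F : EuclideanSpace ℝ (Fin d) → ℝ := fun x ↦ f (toEuclideanCLM (𝕜 := ℝ) A x) * g x with hF
  have hFm : Measurable F := by fun_prop
  have hg0 : ∀ x, 0 < g x := fun x ↦ (Real.exp_pos _).trans_le (hgb x).1
  have hG0 : ∀ x, 0 < G x := fun x ↦ (Real.exp_pos _).trans_le (hGb x).1
  have hf0 : ∀ x, 0 < f x := fun x ↦ (sub_pos.2 hε1).trans_le (hfl x)
  have hexp : ∀ x : EuclideanSpace ℝ (Fin d),
      Real.exp (-η * ‖x‖ ^ 2) ≤ Real.exp (-((c⁻¹ - 1) / 2) * ‖x‖ ^ 2) := fun x ↦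
    Real.exp_le_exp.2 (mul_le_mul_of_nonneg_right (neg_le_neg hεq) (sq_nonneg _))
  have hη1 : (1 + η)⁻¹ ≤ 1 := inv_le_one_of_one_le₀ (by linarith)
  have hη0 : 0 ≤ (1 + η)⁻¹ := by positivity
  have hFl : ∀ x, (1 + η)⁻¹ * Real.exp (-η * ‖x‖ ^ 2) ≤ F x := fun x ↦
    mul_le_mul (hεl.trans (hfl _)) ((hexp x).trans (hgb x).1) (Real.exp_pos _).le (hf0 _).le
  have hFu : ∀ x, F x ≤ 1 + η := fun x ↦
    (mul_le_mul (hfu _) (hgb x).2 (hg0 x).le ha0.le).trans hεC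
  have hGl : ∀ x, (1 + η)⁻¹ * Real.exp (-η * ‖x‖ ^ 2) ≤ G x := fun x ↦
    (mul_le_of_le_one_left (Real.exp_pos _).le hη1).trans ((hexp x).trans (hGb x).1)
  have hGu : ∀ x, G x ≤ 1 + η := fun x ↦
    ((hGb x).2.trans (le_mul_of_one_le_left (by positivity) (by linarith))).trans hεC
  have hPF : P.map (toEuclideanCLM (𝕜 := ℝ) M)
      = (stdGaussian _).withDensity fun x ↦ ENNReal.ofReal (F x) := by
    have e1 : P = ((stdGaussian (EuclideanSpace ℝ (Fin d))).withDensity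
        fun x ↦ ENNReal.ofReal (F x)).map (toEuclideanCLM (𝕜 := ℝ) A) := by
      have e2 : multivariateGaussian 0 K
          = (multivariateGaussian 0 (a⁻¹ • (1 : Matrix (Fin d) (Fin d) ℝ))).map
            (toEuclideanCLM (𝕜 := ℝ) A) := by
        rw [map_multivariateGaussian_zero hIp.posSemidef, Matrix.mul_smul, Matrix.mul_one,
          Matrix.smul_mul, hAA, smul_smul, inv_mul_cancel₀ ha0.ne', one_smul]
      conv_lhs => rw [hPf]
      rw [e2, withDensity_map _ (by fun_prop) (by fun_prop), hgI,
        ← withDensity_mul _ (by fun_prop) (by fun_prop)]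
      congr 2
      ext x
      rw [Pi.mul_apply, hF, mul_comm, ← ENNReal.ofReal_mul (hf0 _).le]
    conv_lhs => rw [e1]
    rw [Measure.map_map (by fun_prop) (by fun_prop)]
    have : (toEuclideanCLM (𝕜 := ℝ) M) ∘ (toEuclideanCLM (𝕜 := ℝ) A) = id := by
      ext1 x
      have := congrArg (fun T ↦ T x) (map_mul (toEuclideanCLM (n := Fin d) (𝕜 := ℝ)) M A)
      simp only [hMA, map_one] at this
      exact this.symm
    rw [this, Measure.map_id]
  have hQG : (multivariateGaussian 0 K').map (toEuclideanCLM (𝕜 := ℝ) M)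
      = (stdGaussian _).withDensity fun x ↦ ENNReal.ofReal (G x) := by
    rw [map_multivariateGaussian_zero hK'p.posSemidef, ← hGS]
  have hPM : IsProbabilityMeasure (P.map (toEuclideanCLM (𝕜 := ℝ) M)) :=
    Measure.isProbabilityMeasure_map (by fun_prop)
  have hQM : IsProbabilityMeasure ((multivariateGaussian 0 K').map (toEuclideanCLM (𝕜 := ℝ) M)) :=
    Measure.isProbabilityMeasure_map (by fun_prop)
  have hγ2 : MemLp id 2 (multivariateGaussian (0 : EuclideanSpace ℝ (Fin d)) K') :=
    IsGaussian.memLp_two_id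
  have hγ0 : ∫ x, x ∂(multivariateGaussian (0 : EuclideanSpace ℝ (Fin d)) K') = 0 :=
    integral_id_multivariateGaussian
  have horth : OrthQuadratic (fun x ↦ F x - G x) :=
    orthQuadratic_sub_of_moments hFm hG (fun x ↦ mul_nonneg (hf0 _).le (hg0 _).le)
      (fun x ↦ (hG0 x).le) hFu hGu hPF hQG
      (fun v ↦ by
        rw [(integral_inner_toEuclideanCLM h2 hP0 M v).1,
          (integral_inner_toEuclideanCLM hγ2 hγ0 M v).1])
      (fun v ↦ by
        rw [(integral_inner_toEuclideanCLM h2 hP0 M v).2,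
          (integral_inner_toEuclideanCLM hγ2 hγ0 M v).2,
          covMat_multivariateGaussian 0 hK'p.posSemidef])
  have hfin := hmain F G hFm hG hFl hFu hGl hGu horth
  rw [← hPF, ← hQG] at hfin
  -- back to the original coordinates
  set T := u • (1 : Matrix (Fin d) (Fin d) ℝ) - s • (A * Aᵀ) with hT
  have hTp : T.PosSemidef := by
    refine PosSemidef.of_dotProduct_mulVec_nonneg ?_ fun v ↦ ?_
    · rw [hT, hAA, IsHermitian, conjTranspose_eq_transpose_of_trivial, transpose_sub,
        transpose_smul, transpose_smul, transpose_smul, transpose_one, ← hRK, transpose_mul, hRt]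
    · rw [star_trivial, hT, hAA, sub_mulVec, smul_mulVec, one_mulVec, smul_smul, smul_mulVec,
        dotProduct_sub, dotProduct_smul, dotProduct_smul, smul_eq_mul, smul_eq_mul]
      have h3 := mul_le_mul_of_nonneg_left (hk v) (mul_nonneg hs.le ha0.le)
      have h4 := mul_le_mul_of_nonneg_right hεu (hvv v)
      linarith
  have hback : ∀ μ : Measure (EuclideanSpace ℝ (Fin d)), IsProbabilityMeasure μ →
      ((ouMeasure ρ (μ.map (toEuclideanCLM (𝕜 := ℝ) M))).map
        (toEuclideanCLM (𝕜 := ℝ) (ρ⁻¹ • A))).conv (multivariateGaussian 0 T)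
        = μ.conv (multivariateGaussian 0 (u • 1)) := by
    intro μ hμ
    have : IsProbabilityMeasure (μ.map (toEuclideanCLM (𝕜 := ℝ) M)) :=
      Measure.isProbabilityMeasure_map (by fun_prop)
    rw [map_ouMeasure_conv_multivariateGaussian hρ0 hρ1.le _ A hTp, hcomp, hρs, hT,
      add_sub_cancel]
  have hou : ∀ μ : Measure (EuclideanSpace ℝ (Fin d)), IsProbabilityMeasure μ →
      IsProbabilityMeasure (ouMeasure ρ μ) := fun μ hμ ↦ by
    unfold ouMeasure; infer_instance
  have := hou _ hPM
  have := hou _ hQM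
  -- Data processing discards the leftover noise and the linear rescaling; the entropic contraction
  -- is applied in whitened coordinates, and data processing once more removes the whitening.
  calc _ ≤ ENNReal.ofReal (1 + u) * klDiv (ouMeasure ρ (P.map (toEuclideanCLM (𝕜 := ℝ) M)))
        (ouMeasure ρ ((multivariateGaussian 0 K').map (toEuclideanCLM (𝕜 := ℝ) M))) := by
        gcongr
        rw [← hback P hPp, ← hback _ inferInstance]
        exact (klDiv_conv_right_le _ _ _).trans (klDiv_map_le _ _ (by fun_prop))
    _ ≤ _ := hfin
    _ ≤ _ := klDiv_map_le _ _ (by fun_prop)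

end Contraction

/-! ### Consequences for the functionals, and degenerate Gaussians. -/

section Functionals

open Matrix WithLp InformationTheory Filter
open scoped MatrixOrder Topology

variable {d : ℕ}

lemma absolutelyContinuous_multivariateGaussian {S : Matrix (Fin d) (Fin d) ℝ} (hS : S.PosDef) :
    multivariateGaussian 0 S ≪ volume := by
  rw [multivariateGaussian_eq_withDensity 0 hS]
  exact withDensity_absolutelyContinuous _ _

/-- A degenerate Gaussian measure is singular. -/
lemma not_absolutelyContinuous_of_not_posDef {K : Matrix (Fin d) (Fin d) ℝ} (hK : K.PosSemidef)
    (hK' : ¬ K.PosDef) {P : Measure (EuclideanSpace ℝ (Fin d))} [IsProbabilityMeasure P]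
    (hP : P ≪ multivariateGaussian 0 K) : ¬ P ≪ volume := by
  intro hv
  -- In a null direction v of K the coordinate ⟨v, x⟩ has zero variance, so P lives on the
  -- hyperplane orthogonal to v, which is Lebesgue null.
  obtain ⟨v, hv0, hvK⟩ : ∃ v : Fin d → ℝ, v ≠ 0 ∧ v ⬝ᵥ K *ᵥ v = 0 := by
    by_contra! hne
    refine hK' (PosDef.of_dotProduct_mulVec_pos hK.isHermitian fun v hv ↦ ?_)
    have := hK.dotProduct_mulVec_nonneg v
    rw [star_trivial] at this ⊢
    exact this.lt_of_ne' (hne v hv)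
  have hγ : MemLp id 2 (multivariateGaussian (0 : EuclideanSpace ℝ (Fin d)) K) :=
    IsGaussian.memLp_two_id
  have e := dotProduct_covMat_mulVec hγ (toLp 2 v)
  rw [covMat_multivariateGaussian 0 hK, integral_id_multivariateGaussian] at e
  simp only [sub_zero] at e
  have hI : Integrable (fun x ↦ inner ℝ (toLp 2 v) x ^ 2)
      (multivariateGaussian (0 : EuclideanSpace ℝ (Fin d)) K) :=
    ((innerSL ℝ (toLp 2 v)).comp_memLp' hγ).integrable_sq
  rw [hvK, integral_eq_zero_iff_of_nonneg (fun x ↦ sq_nonneg _) hI] at e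
  have hker : ∀ᵐ x ∂P, x ∈ LinearMap.ker (innerSL ℝ (toLp 2 v)).toLinearMap := by
    filter_upwards [hP.ae_le e] with x hx
    simpa using hx
  have hsub : LinearMap.ker (innerSL ℝ (toLp 2 v)).toLinearMap ≠ ⊤ := by
    intro htop
    have : toLp 2 v ∈ LinearMap.ker (innerSL ℝ (toLp 2 v)).toLinearMap := by rw [htop]; trivial
    have h0 : inner ℝ (toLp 2 v) (toLp 2 v) = 0 := this
    rw [inner_self_eq_zero] at h0
    exact hv0 (by simpa using h0)
  have h0 := hv (Measure.addHaar_submodule volume _ hsub)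
  rw [ae_iff] at hker
  have h1 : P Set.univ ≤ 0 := by
    rw [← Set.union_compl_self
      (LinearMap.ker (innerSL ℝ (toLp 2 v)).toLinearMap : Set (EuclideanSpace ℝ (Fin d)))]
    refine (measure_union_le _ _).trans ?_
    rw [h0, zero_add]
    exact hker.le
  simp at h1

lemma posDef_smul_one {u : ℝ} (hu : 0 < u) :
    (u • (1 : Matrix (Fin d) (Fin d) ℝ)).PosDef := PosDef.one.smul hu

/-- Replacing the inner supremum by the Gaussian bound on the entropy. -/
lemma Psi_le_Theta {u : ℝ} (hu : 0 < u) (L : Matrix (Fin d) (Fin d) ℝ)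
    {P : Measure (EuclideanSpace ℝ (Fin d))} [IsProbabilityMeasure P] (hP : MemLp id 2 P) :
    Psi u P L ≤ Theta u P L := by
  have hγ : MemLp id 2 (multivariateGaussian (0 : EuclideanSpace ℝ (Fin d)) (u • 1)) :=
    IsGaussian.memLp_two_id
  refine iSup₂_le fun Q ⟨hQp, hQ, hLQ⟩ ↦ ?_
  unfold Theta gaussianIso gaussianCov
  refine EReal.sub_le_sub (add_le_add_left ?_ _) le_rfl
  have hPγ := memLp_id_conv hP hγ
  have hc : covMat ((P.conv (multivariateGaussian 0 (u • 1))).conv Q)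
      = covMat P + u • 1 + covMat Q := by
    rw [covMat_conv hPγ hQ, covMat_conv hP hγ,
      covMat_multivariateGaussian 0 (posDef_smul_one hu).posSemidef]
  have hpd : (covMat P + u • 1 + covMat Q).PosDef :=
    ((posDef_smul_one hu).posSemidef_add (posSemidef_covMat hP)).add_posSemidef
      (posSemidef_covMat hQ)
  have hdet := det_le_det_add hpd hLQ
  rw [show covMat P + u • 1 + covMat Q + (L - covMat Q) = covMat P + u • 1 + L by abel] at hdet
  have hpos := hpd.det_pos
  have hle := diffEntropy_le (memLp_id_conv hPγ hQ) (by rwa [hc])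
  rw [hc] at hle
  refine (mul_le_mul_of_nonneg_left hle (EReal.coe_nonneg.2 hu.le)).trans ?_
  rw [← EReal.coe_mul, EReal.coe_le_coe_iff, ← mul_assoc, mul_one_div]
  gcongr

/-- If `P` is not absolutely continuous, both functionals are `-∞`. -/
lemma Theta_Psi_of_not_absolutelyContinuous (u : ℝ) (L : Matrix (Fin d) (Fin d) ℝ)
    {P : Measure (EuclideanSpace ℝ (Fin d))} (hP : ¬ P ≪ volume) :
    Theta u P L = ⊥ ∧ Psi u P L = ⊥ := by
  have h : diffEntropy P = ⊥ := by rw [diffEntropy, if_neg hP]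
  constructor
  · rw [Theta, h, EReal.add_bot, EReal.bot_sub]
  · rw [eq_bot_iff]
    refine iSup₂_le fun Q _ ↦ ?_
    rw [h, EReal.add_bot, EReal.bot_sub]

lemma diffEntropy_multivariateGaussian {S : Matrix (Fin d) (Fin d) ℝ} (hS : S.PosDef) :
    diffEntropy (multivariateGaussian 0 S)
      = ((1 / 2 * Real.log ((2 * Real.pi * Real.exp 1) ^ d * S.det) : ℝ) : EReal) := by
  have hc := covMat_multivariateGaussian 0 hS.posSemidef
  rw [diffEntropy_eq_sub_klDiv (absolutelyContinuous_multivariateGaussian hS)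
    IsGaussian.memLp_two_id (by rwa [hc]), hc, integral_id_multivariateGaussian, klDiv_self]
  simp

/-- Divergence contraction makes the Gaussian with the same covariance better. -/
lemma Theta_le_Theta_gaussianCov {u : ℝ} (hu : 0 < u) (L : Matrix (Fin d) (Fin d) ℝ)
    {P : Measure (EuclideanSpace ℝ (Fin d))} [IsProbabilityMeasure P] (hac : P ≪ volume)
    (h0 : ∫ x, x ∂P = 0) (h2 : MemLp id 2 P) (hcov : (covMat P).PosDef)
    (h : ENNReal.ofReal (1 + u) * klDiv (P.conv (multivariateGaussian 0 (u • 1)))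
            ((multivariateGaussian 0 (covMat P)).conv (multivariateGaussian 0 (u • 1)))
          ≤ klDiv P (multivariateGaussian 0 (covMat P))) :
    Theta u P L ≤ Theta u (gaussianCov (covMat P)) L := by
  have hup := posDef_smul_one (d := d) hu
  have hγ : MemLp id 2 (multivariateGaussian (0 : EuclideanSpace ℝ (Fin d)) (u • 1)) :=
    IsGaussian.memLp_two_id
  have hγ0 : ∫ x, x ∂(multivariateGaussian (0 : EuclideanSpace ℝ (Fin d)) (u • 1)) = 0 :=
    integral_id_multivariateGaussian
  have hK := hcov.posSemidef
  have hKu : (covMat P + u • 1).PosDef := hcov.add hup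
  have hconv := multivariateGaussian_conv hK hup.posSemidef
  have hcPγ : covMat (P.conv (multivariateGaussian 0 (u • 1))) = covMat P + u • 1 := by
    rw [covMat_conv h2 hγ, covMat_multivariateGaussian 0 hup.posSemidef]
  have hmPγ : ∫ x, x ∂(P.conv (multivariateGaussian 0 (u • 1))) = 0 := by
    rw [integral_id_conv (h2.integrable (by norm_num)) (hγ.integrable (by norm_num)), h0, hγ0,
      add_zero]
  have hacPγ : P.conv (multivariateGaussian 0 (u • 1)) ≪ volume :=
    Measure.conv_absolutelyContinuous (absolutelyContinuous_multivariateGaussian hup)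
  have E1 := diffEntropy_eq_sub_klDiv hac h2 hcov
  have E2 := diffEntropy_eq_sub_klDiv hacPγ (memLp_id_conv h2 hγ) (by rwa [hcPγ])
  rw [h0] at E1
  rw [hmPγ, hcPγ] at E2
  rw [hconv] at h
  unfold Theta gaussianIso gaussianCov
  rw [hconv, covMat_multivariateGaussian 0 hK, diffEntropy_multivariateGaussian hcov,
    diffEntropy_multivariateGaussian hKu, E1, E2]
  generalize klDiv P (multivariateGaussian 0 (covMat P)) = D0 at h ⊢
  generalize klDiv (P.conv (multivariateGaussian 0 (u • 1)))
    (multivariateGaussian 0 (covMat P + u • 1)) = D1 at h ⊢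
  generalize 1 / 2 * Real.log ((2 * Real.pi * Real.exp 1) ^ d * (covMat P).det) = H0
  generalize 1 / 2 * Real.log ((2 * Real.pi * Real.exp 1) ^ d * (covMat P + u • 1).det) = H1
  generalize u / 2 * Real.log _ = C
  -- An infinite divergence makes the left side −∞. Otherwise D1 is finite as well, since 1 + u > 0,
  -- and the inequality is one between real numbers.
  by_cases hD : D0 = ⊤
  · rw [hD, EReal.coe_ennreal_top, EReal.sub_top, EReal.add_bot, EReal.bot_sub]
    exact bot_le
  have hD1 : D1 ≠ ⊤ := by
    rintro rfl
    rw [ENNReal.mul_top (by simpa using by linarith)] at h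
    exact hD (top_le_iff.1 h)
  have hle := ENNReal.toReal_mono hD h
  rw [ENNReal.toReal_mul, ENNReal.toReal_ofReal (by linarith)] at hle
  rw [← EReal.coe_ennreal_toReal hD, ← EReal.coe_ennreal_toReal hD1, ← EReal.coe_sub,
    ← EReal.coe_sub, ← EReal.coe_mul, ← EReal.coe_mul, ← EReal.coe_add, ← EReal.coe_add,
    ← EReal.coe_sub, ← EReal.coe_sub, EReal.coe_le_coe_iff]
  linarith

lemma dotProduct_mulVec_le_of_eigenvalues_le {K : Matrix (Fin d) (Fin d) ℝ} (hK : K.IsHermitian)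
    {k : ℝ} (h : ∀ i, hK.eigenvalues i ≤ k) (v : Fin d → ℝ) :
    v ⬝ᵥ K *ᵥ v ≤ k * (v ⬝ᵥ v) := by
  have e1 : v ⬝ᵥ K *ᵥ v = inner ℝ (toLp 2 v) (toEuclideanCLM (𝕜 := ℝ) K (toLp 2 v)) := by
    rw [inner_toEuclideanCLM]
  set b := hK.eigenvectorBasis
  have e2 : ∀ i, inner ℝ (toEuclideanCLM (𝕜 := ℝ) K (toLp 2 v)) (b i)
      = hK.eigenvalues i * inner ℝ (toLp 2 v) (b i) := by
    intro i
    have hKt : Kᵀ = K := by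
      have := hK; rwa [IsHermitian, conjTranspose_eq_transpose_of_trivial] at this
    have e3 : toEuclideanCLM (𝕜 := ℝ) K (b i) = hK.eigenvalues i • b i := by
      refine WithLp.ofLp_injective 2 ?_
      exact hK.mulVec_eigenvectorBasis i
    rw [inner_toEuclideanCLM_left, hKt, e3, inner_smul_right]
  have e4 : v ⬝ᵥ v = ∑ i, inner ℝ (toLp 2 v) (b i) ^ 2 := by
    rw [b.sum_sq_inner_left, norm_sq_eq_dotProduct]
  rw [e1, real_inner_comm, ← b.sum_inner_mul_inner, e4, Finset.mul_sum]
  refine Finset.sum_le_sum fun i _ ↦ ?_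
  rw [e2, real_inner_comm (b i), mul_assoc, ← pow_two]
  exact mul_le_mul_of_nonneg_right (h i) (sq_nonneg _)

end Functionals

/-! ### The local optimality theorem. -/

theorem theorem5 {d : ℕ} (hd : 0 < d) {u : ℝ} (hu : 0 < u)
    (L : Matrix (Fin d) (Fin d) ℝ) (hL : L.PosSemidef)
    (K : Matrix (Fin d) (Fin d) ℝ) (hK : K.PosSemidef)
    (hmax : IsMaxOn (fun K' : Matrix (Fin d) (Fin d) ℝ => Theta u (gaussianCov K') L)
      {K' | K'.PosSemidef} K)
    (htop : ∀ i, hK.isHermitian.eigenvalues i < u / ((1 + u) ^ (1 / 3 : ℝ) - 1)) :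
    ∃ ε : ℝ, 0 < ε ∧ ∀ P : Measure (EuclideanSpace ℝ (Fin d)), IsProbabilityMeasure P →
      linftyDist P (gaussianCov K) ≤ ENNReal.ofReal ε → ∫ x, x ∂P = 0 →
        Theta u P L ≤ Phi u L ∧ Psi u P L ≤ Phi u L := by
  by_cases hKp : K.PosDef
  · have : Nonempty (Fin d) := ⟨⟨0, hd⟩⟩
    obtain ⟨i, hi⟩ := Finite.exists_max hK.isHermitian.eigenvalues
    obtain ⟨ε, hε, hmain⟩ := exists_klDiv_conv_le hKp hu (hKp.eigenvalues_pos i)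
      (dotProduct_mulVec_le_of_eigenvalues_le hK.isHermitian hi) (htop i)
    refine ⟨ε, hε, fun P hP hPε hP0 ↦ ?_⟩
    obtain ⟨h2, hcov, hkl⟩ := hmain P hP hPε hP0
    have hac : P ≪ volume := by
      obtain ⟨f, -, -, -, hf⟩ := exists_density_of_linftyDist_le
        (Q := multivariateGaussian 0 K) hε.le hPε
      rw [hf]
      exact (withDensity_absolutelyContinuous _ _).trans
        (absolutelyContinuous_multivariateGaussian hKp)
    have hT : Theta u P L ≤ Phi u L :=
      (Theta_le_Theta_gaussianCov hu L hac hP0 h2 hcov hkl).trans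
        (le_iSup₂_of_le (covMat P) hcov.posSemidef le_rfl)
    exact ⟨hT, (Psi_le_Theta hu L h2).trans hT⟩
  -- Any radius works here: P ≪ γ_K with K singular already forces both functionals to be −∞.
  · refine ⟨1, one_pos, fun P hP hPε _ ↦ ?_⟩
    have hac : P ≪ multivariateGaussian 0 K := by
      obtain ⟨f, -, -, -, hf⟩ := exists_density_of_linftyDist_le
        (Q := multivariateGaussian 0 K) zero_le_one hPε
      rw [hf]
      exact withDensity_absolutelyContinuous _ _
    obtain ⟨h1, h2⟩ := Theta_Psi_of_not_absolutelyContinuous u L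
      (not_absolutelyContinuous_of_not_posDef hK hKp hac)
    rw [h1, h2]
    exact ⟨bot_le, bot_le⟩
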